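/- Let $N\in\mathbb N$ and let $D_N=\mathbb C^N$ with componentwise operations, $D_N^{-1}=\{(\alpha_1,\dots,\alpha_N)\in D_N:\alpha_j\neq 0\ \forall j\}$. Let $\Theta_{D_N}\subset D_N[[z]]$ be the set of formal power series with zero constant term. For $g_1=\sum_{n\ge1}a_nz^n$ and $g_2=\sum_{n\ge1}b_nz^n$ in $\Theta_{D_N}$ the restricted $D_N$-valued boxed convolution is $$g_1\boxtimes_{D_N}g_2=\sum_{n\ge1}\Big(\sum_{\pi\in NC(n)}a_\pi\, b_{Kr(\pi)}\Big)z^n,\qquad a_\theta=\prod_{V\in\theta}a_{|V|},\quad b_\theta=\prod_{V\in\theta}b_{|V|},$$ where $NC(n)$ is the set of noncrossing partitions of $\{1,\dots,n\}$ and $Kr$ is the Kreweras complementation map. Let $\Theta_{D_N}^{inv}$ be the set of $g\in\Theta_{D_N}$ that are $\boxtimes_{D_N}$-invertible, i.e. for which there is $h\in\Theta_{D_N}$ with $g\boxtimes_{D_N}h=h\boxtimes_{D_N}g=z$, and let $D_N^{inv}[[z]]$ be the set of series in $D_N[[z]]$ whose constant term lies in $D_N^{-1}$. Then: 1. A series $g=\sum_{n\ge1}d_nz^n\in\Theta_{D_N}$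 lies in $\Theta_{D_N}^{inv}$ if and only if $d_1\in D_N^{-1}$. 2. $(\Theta_{D_N}^{inv},\boxtimes_{D_N})$ is a group with identity $z$, and $(D_N^{inv}[[z]],\cdot)$, with the usual multiplication of power series, is a group. 3. Every $g\in\Theta_{D_N}^{inv}$ has a unique inverse $g^{<-1>}\in\Theta_{D_N}$ with respect to composition, and $$F(g)=\frac1z\,g^{<-1>}(z)$$ defines an injective group homomorphism $F:(\Theta_{D_N}^{inv},\boxtimes_{D_N})\to(D_N^{inv}[[z]],\cdot)$. -/

import Mathlib

open scoped PowerSeries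

/-! ### Noncrossing partitions and the Kreweras complement -/

/-- The equivalence relation "`i` and `j` lie in the same block of `π`". -/
def blockRel {n : ℕ} (π : Finpartition (Finset.univ : Finset (Fin n))) : Setoid (Fin n) where
  r i j := π.part i = π.part j
  iseqv := ⟨fun _ => rfl, fun h => h.symm, fun h h' => h.trans h'⟩

/-- An equivalence relation on a linearly ordered set is noncrossing if no two distinct classes
interlace: `a < b < c < d` with `a ∼ c` and `b ∼ d` forces `a ∼ b`. -/
def IsNoncrossing {α : Type*} [LinearOrder α] (r : Setoid α) : Prop :=
  ∀ a b c d : α, a < b → b < c → c < d → r a c → r b d → r a b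

/-- `NC(n)`: the noncrossing partitions of an `n`-element linearly ordered set. -/
abbrev NCPartition (n : ℕ) : Type :=
  {π : Finpartition (Finset.univ : Finset (Fin n)) // IsNoncrossing (blockRel π)}

noncomputable instance instFintypeNCPartition (n : ℕ) : Fintype (NCPartition n) :=
  Fintype.ofFinite _

/-- The relation defining the Kreweras complement of `π`: `i` and `j` are related when the
half-open interval of points `a` with `min i j < a ≤ max i j` (that is, the points `a` for which
`i < a` and `j < a` are not equivalent) is a union of blocks of `π`. -/
def krewerasRel {n : ℕ} (π : Finpartition (Finset.univ : Finset (Fin n))) : Setoid (Fin n) where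
  r i j := ∀ a b : Fin n, blockRel π a b → ((i < a ↔ j < a) ↔ (i < b ↔ j < b))
  iseqv := by
    refine ⟨fun i a b _ => by simp, fun h a b hab => ?_, fun h h' a b hab => ?_⟩
    · have := h a b hab
      tauto
    · have h1 := h a b hab
      have h2 := h' a b hab
      tauto

theorem isNoncrossing_krewerasRel {n : ℕ} (π : Finpartition (Finset.univ : Finset (Fin n))) :
    IsNoncrossing (krewerasRel π) := by
  intro i k j l hik hkj hjl hij hkl a b hab
  have h1 := hij a b hab
  have h2 := hkl a b hab
  simp only [Fin.lt_def] at *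
  by_cases ha1 : i.1 < a.1 <;> by_cases ha2 : k.1 < a.1 <;> by_cases ha3 : j.1 < a.1 <;>
    by_cases ha4 : l.1 < a.1 <;> by_cases hb1 : i.1 < b.1 <;> by_cases hb2 : k.1 < b.1 <;>
    by_cases hb3 : j.1 < b.1 <;> by_cases hb4 : l.1 < b.1 <;>
    omega

open Classical in
/-- The partition of `Fin n` into the classes of an equivalence relation has this relation as
its block relation. -/
theorem blockRel_ofSetoid {n : ℕ} (r : Setoid (Fin n)) :
    blockRel (Finpartition.ofSetoid r) = r := by
  ext i j
  change (Finpartition.ofSetoid r).part i = (Finpartition.ofSetoid r).part j ↔ r i j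
  rw [← Finpartition.mem_part_iff_part_eq_part _ (Finset.mem_univ i) (Finset.mem_univ j),
    Finpartition.mem_part_ofSetoid_iff_rel]
  exact ⟨fun h => r.symm h, fun h => r.symm h⟩

open Classical in
/-- The Kreweras complementation map `Kr : NC(n) → NC(n)`; see `kreweras_isGreatest`. -/
noncomputable def kreweras {n : ℕ} (π : NCPartition n) : NCPartition n :=
  ⟨Finpartition.ofSetoid (krewerasRel π.1), by
    rw [blockRel_ofSetoid]; exact isNoncrossing_krewerasRel π.1⟩

/-- The relation `π ∪ σ` on `1 < 1' < 2 < 2' < ⋯ < n < n'`, where `π` partitions the points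
`i = (i, false)` and `σ` partitions the points `i' = (i, true)`. -/
def interleave {n : ℕ} (π σ : Setoid (Fin n)) : Setoid (Fin n ×ₗ Bool) where
  r x y := (ofLex x).2 = (ofLex y).2 ∧
    ((ofLex x).2 = false → π (ofLex x).1 (ofLex y).1) ∧
    ((ofLex x).2 = true → σ (ofLex x).1 (ofLex y).1)
  iseqv := by
    refine ⟨fun x => ⟨rfl, fun _ => π.refl _, fun _ => σ.refl _⟩, fun h => ?_, fun h h' => ?_⟩
    · exact ⟨h.1.symm, fun e => π.symm (h.2.1 (h.1.trans e)),
        fun e => σ.symm (h.2.2 (h.1.trans e))⟩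
    · exact ⟨h.1.trans h'.1, fun e => π.trans (h.2.1 e) (h'.2.1 (h.1.symm.trans e)),
        fun e => σ.trans (h.2.2 e) (h'.2.2 (h.1.symm.trans e))⟩

theorem kreweras_interleave {n : ℕ} (π : NCPartition n) :
    IsNoncrossing (interleave (blockRel π.1) (krewerasRel π.1)) := by
  have hK := isNoncrossing_krewerasRel π.1
  have hπ := π.2
  intro x y z w hxy hyz hzw hxz hyw
  obtain ⟨⟨a, s⟩, rfl⟩ := toLex.surjective x
  obtain ⟨⟨b, t⟩, rfl⟩ := toLex.surjective y
  obtain ⟨⟨c, u⟩, rfl⟩ := toLex.surjective z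
  obtain ⟨⟨d, v⟩, rfl⟩ := toLex.surjective w
  obtain ⟨h1, h2, h3⟩ := hxz
  obtain ⟨h4, h5, h6⟩ := hyw
  simp only [ofLex_toLex] at h1 h2 h3 h4 h5 h6
  subst h1 h4
  simp only [Prod.Lex.toLex_lt_toLex] at hxy hyz hzw
  cases s <;> cases t <;> simp at h2 h3 h5 h6 hxy hyz hzw
  · refine ⟨rfl, fun _ => hπ a b c d hxy hyz hzw h2 h5, by simp⟩
  · exfalso
    have hyz' : b < c := hyz.resolve_right (fun h => absurd h.2 (by decide))
    have hxy' : a ≤ b := le_of_lt_or_eq hxy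
    have hzw' : c ≤ d := le_of_lt_or_eq hzw
    have := h6 a c h2
    simp only [Fin.lt_def, Fin.le_def] at this hxy' hyz' hzw'
    omega
  · exfalso
    have hyz' : b ≤ c := le_of_lt_or_eq hyz
    have hxy' : a < b := hxy.resolve_right (fun h => absurd h.2 (by decide))
    have hzw' : c < d := hzw.resolve_right (fun h => absurd h.2 (by decide))
    have := h3 b d h5
    simp only [Fin.lt_def, Fin.le_def] at this hxy' hyz' hzw'
    omega
  · refine ⟨rfl, by simp, fun _ => hK a b c d hxy hyz hzw h3 h6⟩

/-- `Kr(π)` is the largest noncrossing partition `σ` of `1' < ⋯ < n'` for which `π ∪ σ` is a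
noncrossing partition of `1 < 1' < 2 < 2' < ⋯ < n < n'`. -/
theorem kreweras_isGreatest {n : ℕ} (π : NCPartition n) :
    IsGreatest {σ : NCPartition n | IsNoncrossing (interleave (blockRel π.1) (blockRel σ.1))}
      (kreweras π) := by
  classical
  have hKr : blockRel (kreweras π).1 = krewerasRel π.1 := blockRel_ofSetoid _
  constructor
  · change IsNoncrossing _
    rw [hKr]
    exact kreweras_interleave π
  · intro σ hσ
    have key : ∀ i j : Fin n, i < j → blockRel σ.1 i j → krewerasRel π.1 i j := by
      have aux : ∀ i j a b : Fin n, i < j → blockRel σ.1 i j → blockRel π.1 a b →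
          i < a → a ≤ j → i < b ∧ b ≤ j := by
        intro i j a b hij hs hab hia haj
        by_contra hcon
        rcases lt_or_ge i b with hb | hb
        · have hjb : j < b := by
            by_contra hh
            exact hcon ⟨hb, not_lt.mp hh⟩
          have := hσ (toLex (i, true)) (toLex (a, false)) (toLex (j, true)) (toLex (b, false))
            (by simp [Prod.Lex.toLex_lt_toLex, hia])
            (by simpa [Prod.Lex.toLex_lt_toLex] using lt_or_eq_of_le haj)
            (by simp [Prod.Lex.toLex_lt_toLex, hjb])
            ⟨rfl, by simp, fun _ => hs⟩ ⟨rfl, fun _ => hab, by simp⟩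
          exact absurd this.1 (by simp)
        · have := hσ (toLex (b, false)) (toLex (i, true)) (toLex (a, false)) (toLex (j, true))
            (by simpa [Prod.Lex.toLex_lt_toLex] using lt_or_eq_of_le hb)
            (by simp [Prod.Lex.toLex_lt_toLex, hia])
            (by simpa [Prod.Lex.toLex_lt_toLex] using lt_or_eq_of_le haj)
            ⟨rfl, fun _ => (blockRel π.1).symm hab, by simp⟩ ⟨rfl, by simp, fun _ => hs⟩
          exact absurd this.1 (by simp)
      intro i j hij hs a b hab
      have h1 := aux i j a b hij hs hab
      have h2 := aux i j b a hij hs ((blockRel π.1).symm hab)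
      simp only [Fin.lt_def, Fin.le_def] at *
      omega
    have key' : ∀ i j : Fin n, blockRel σ.1 i j → blockRel (kreweras π).1 i j := by
      intro i j hs
      rw [hKr]
      rcases lt_trichotomy i j with h | h | h
      · exact key i j h hs
      · subst h; exact (krewerasRel π.1).refl _
      · exact (krewerasRel π.1).symm (key j i h ((blockRel σ.1).symm hs))
    intro B hB
    obtain ⟨i, hi⟩ := σ.1.nonempty_of_mem_parts hB
    refine ⟨(kreweras π).1.part i, by simp, fun j hj => ?_⟩
    have hij : blockRel σ.1 i j :=
      (σ.1.part_eq_of_mem hB hi).trans (σ.1.part_eq_of_mem hB hj).symm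
    exact (Finpartition.mem_part_iff_part_eq_part _ (Finset.mem_univ j) (Finset.mem_univ i)).2
      (key' i j hij).symm

/-! ### The restricted boxed convolution -/

/-- `a_π = ∏_{V ∈ π} a_{|V|}` for the coefficient sequence `a` of a power series. -/
noncomputable def partitionCoeff {R : Type*} [CommRing R] (g : R⟦X⟧) {n : ℕ}
    (π : NCPartition n) : R :=
  ∏ V ∈ π.1.parts, PowerSeries.coeff V.card g

/-- The restricted boxed convolution: the series without constant term whose `n`-th coefficient is
`∑_{π ∈ NC(n)} a_π b_{Kr(π)}` for `n ≥ 1`. -/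
noncomputable def boxedConv {R : Type*} [CommRing R] (f g : R⟦X⟧) : R⟦X⟧ :=
  PowerSeries.mk fun n =>
    if n = 0 then 0 else ∑ π : NCPartition n, partitionCoeff f π * partitionCoeff g (kreweras π)

/-- `h` is the compositional inverse `g^{<-1>}` of `g`, among series without constant term. -/
def IsCompInverse {R : Type*} [CommRing R] (g h : R⟦X⟧) : Prop :=
  PowerSeries.constantCoeff h = 0 ∧
    PowerSeries.subst h g = (PowerSeries.X : R⟦X⟧) ∧
    PowerSeries.subst g h = (PowerSeries.X : R⟦X⟧)

/-! ### The diagonal algebra and the two groups -/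

/-- The `N`-th diagonal algebra `D_N = ℂ^N`, with componentwise operations. -/
abbrev DiagAlg (N : ℕ) : Type := Fin N → ℂ

/-- `D_N^{-1}`: the elements of `D_N` all of whose entries are nonzero. -/
def DiagInv (N : ℕ) : Set (DiagAlg N) := {d | ∀ j, d j ≠ 0}

/-- `Θ_{D_N}`: the series over `D_N` with zero constant term. -/
def Theta (N : ℕ) : Set (DiagAlg N)⟦X⟧ := {g | PowerSeries.constantCoeff g = 0}

/-- `Θ_{D_N}^{inv}`: the elements of `Θ_{D_N}` that are invertible for the boxed convolution, whose
identity is the series `z`. -/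
def ThetaInv (N : ℕ) : Set (DiagAlg N)⟦X⟧ :=
  {g | g ∈ Theta N ∧ ∃ h ∈ Theta N, boxedConv g h = PowerSeries.X ∧ boxedConv h g = PowerSeries.X}

/-- `D_N^{inv}[[z]]`: the series over `D_N` whose constant term lies in `D_N^{-1}`. -/
def InvSeries (N : ℕ) : Set (DiagAlg N)⟦X⟧ := {f | PowerSeries.constantCoeff f ∈ DiagInv N}

/-! Put `π` on the even and `Kr(π)` on the odd points of `0, …, 2n - 1`. The pair becomes one
relation with a self-dual description: points of equal parity are related exactly when no related
pair of the other parity separates them. This makes sense on every interval, and gives two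
recurrences. An interval with an even number of points splits uniquely behind the last point related
to the first one, into two intervals of odd length (`pairsSum_even`). In an interval with an odd
number of points, at least three, the two ends are related, so the first point can be removed if a
counter `s` remembers that the last block had one point more (`pairsSum_odd`).

Let `A` and `B` be the generating functions `oddSeries` with `s = 0` over the intervals starting at
`0` and at `1`. The recurrences give `f ⊠ g = zAB` and, iterated in `s`, `A = ∑ a_{k+1} (zB)^k` and
its mirror image. Hence `f(zB) = zAB = g(zA)` (`subst_oddSeries`). Write `f^{<-1>} = zu`, `g^{<-1>}
= zv` and `h = f ⊠ g`. Then `h u(h) = zB` and `h v(h) = zA`; cancelling gives `A u(h) = 1 = B v(h)`,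
so `h u(h) v(h) = z` and `h^{<-1>} = zuv` (`isCompInverse_boxedConv`).

Thus `F` is multiplicative. It is even a bijection onto the units of `D_N[[z]]`, so the group axioms
for `⊠` are inherited from the units. The criterion for invertibility holds because first
coefficients multiply under `⊠` and, conversely, the series corresponding to `u⁻¹` inverts the one
corresponding to `u`. -/

/-! ### Self-dual relations on intervals. -/

/-- The condition on a pair `x`, `y`, relative to the pairs in `r`, that no related pair of points
of the other parity is separated by `x` and `y`. -/
def Unseparated (r : Finset (ℕ × ℕ)) (x y : ℕ) : Prop :=
  x % 2 = y % 2 ∧ ∀ u v, (u, v) ∈ r → u % 2 ≠ x % 2 → ((x < u ↔ y < u) ↔ (x < v ↔ y < v))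

open Classical in
/-- The relations on the points `i, …, j - 1` which relate points of equal parity, and whose
restrictions to the even and to the odd points are Kreweras complements of each other. -/
noncomputable def krewerasPairs (i j : ℕ) : Finset (Finset (ℕ × ℕ)) :=
  (Finset.Ico i j ×ˢ Finset.Ico i j).powerset.filter fun r =>
    ∀ x ∈ Finset.Ico i j, ∀ y ∈ Finset.Ico i j, (x, y) ∈ r ↔ Unseparated r x y

theorem mem_krewerasPairs {i j : ℕ} {r : Finset (ℕ × ℕ)} :
    r ∈ krewerasPairs i j ↔
      (∀ x y, (x, y) ∈ r → i ≤ x ∧ x < j ∧ i ≤ y ∧ y < j) ∧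
      ∀ x y, i ≤ x → x < j → i ≤ y → y < j → ((x, y) ∈ r ↔ Unseparated r x y) := by
  unfold krewerasPairs
  simp only [Finset.mem_filter, Finset.mem_powerset]
  constructor
  · rintro ⟨h1, h2⟩
    refine ⟨fun x y h => ?_, fun x y a b c d => h2 x (by simp [a, b]) y (by simp [c, d])⟩
    have := h1 h
    simp at this
    omega
  · rintro ⟨h1, h2⟩
    refine ⟨fun ⟨x, y⟩ h => ?_, fun x hx y hy => ?_⟩
    · have := h1 x y h
      simp; omega
    · simp at hx hy
      exact h2 x y hx.1 hx.2 hy.1 hy.2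

theorem Unseparated.refl (r : Finset (ℕ × ℕ)) (x : ℕ) : Unseparated r x x :=
  ⟨rfl, fun _ _ _ _ => by simp⟩

theorem Unseparated.symm {r : Finset (ℕ × ℕ)} {x y : ℕ} (h : Unseparated r x y) :
    Unseparated r y x :=
  ⟨h.1.symm, fun u v huv hu => by have := h.2 u v huv (by rw [h.1]; exact hu); tauto⟩

theorem Unseparated.trans {r : Finset (ℕ × ℕ)} {x y z : ℕ} (h : Unseparated r x y)
    (h' : Unseparated r y z) : Unseparated r x z :=
  ⟨h.1.trans h'.1, fun u v huv hu => by
    have h1 := h.2 u v huv hu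
    have h2 := h'.2 u v huv (by rw [← h.1]; exact hu)
    tauto⟩

section
variable {i j : ℕ} {r : Finset (ℕ × ℕ)}

theorem krewerasPairs_refl (hr : r ∈ krewerasPairs i j) {x : ℕ} (h1 : i ≤ x) (h2 : x < j) :
    (x, x) ∈ r :=
  ((mem_krewerasPairs.1 hr).2 x x h1 h2 h1 h2).2 (.refl r x)

theorem krewerasPairs_unseparated (hr : r ∈ krewerasPairs i j) {x y : ℕ} (h : (x, y) ∈ r) :
    Unseparated r x y := by
  obtain ⟨h1, h2⟩ := mem_krewerasPairs.1 hr
  obtain ⟨a, b, c, d⟩ := h1 x y h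
  exact (h2 x y a b c d).1 h

theorem krewerasPairs_symm (hr : r ∈ krewerasPairs i j) {x y : ℕ} (h : (x, y) ∈ r) :
    (y, x) ∈ r := by
  obtain ⟨h1, h2⟩ := mem_krewerasPairs.1 hr
  obtain ⟨a, b, c, d⟩ := h1 x y h
  exact (h2 y x c d a b).2 (krewerasPairs_unseparated hr h).symm

theorem krewerasPairs_trans (hr : r ∈ krewerasPairs i j) {x y z : ℕ} (h : (x, y) ∈ r)
    (h' : (y, z) ∈ r) : (x, z) ∈ r := by
  obtain ⟨h1, h2⟩ := mem_krewerasPairs.1 hr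
  obtain ⟨a, b, c, d⟩ := h1 x y h
  obtain ⟨-, -, e, f⟩ := h1 y z h'
  exact (h2 x z a b e f).2 ((krewerasPairs_unseparated hr h).trans (krewerasPairs_unseparated hr h'))

/-- In an interval with an odd number of points the two end points are related. -/
theorem krewerasPairs_ends (hr : r ∈ krewerasPairs i j) (hij : (j - i) % 2 = 1) :
    (i, j - 1) ∈ r := by
  obtain ⟨h1, h2⟩ := mem_krewerasPairs.1 hr
  refine (h2 i (j - 1) (by omega) (by omega) (by omega) (by omega)).2 ⟨by omega, ?_⟩
  intro u v huv hu
  have h3 := h1 u v huv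
  have h4 := (krewerasPairs_unseparated hr huv).1
  omega

end

/-! ### Splitting an interval with an even number of points. -/

/-- Both pieces have odd length, so the ends of each are related; these two end pairs keep the
pieces apart. -/
theorem union_mem_krewerasPairs {i k j : ℕ} {p q : Finset (ℕ × ℕ)} (hp : p ∈ krewerasPairs i k)
    (hq : q ∈ krewerasPairs k j) (hik : (k - i) % 2 = 1) (hkj : (j - k) % 2 = 1) :
    p ∪ q ∈ krewerasPairs i j := by
  have ep := krewerasPairs_ends hp hik
  have eq := krewerasPairs_ends hq hkj
  obtain ⟨p1, p2⟩ := mem_krewerasPairs.1 hp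
  obtain ⟨q1, q2⟩ := mem_krewerasPairs.1 hq
  have cross : ∀ x y, i ≤ x → x < k → k ≤ y → y < j → ¬ Unseparated (p ∪ q) x y := by
    rintro x y h1 h2 h3 h4 ⟨h5, h6⟩
    -- The end pairs `(i, k - 1)` and `(k, j - 1)` have opposite parities, and the one whose parity
    -- differs from that of `x` separates `x` from `y`.
    by_cases hx : x % 2 = i % 2
    · have := h6 _ _ (Finset.mem_union_right _ eq) (by omega)
      omega
    · have := h6 _ _ (Finset.mem_union_left _ ep) (by omega)
      omega
  rw [mem_krewerasPairs]
  refine ⟨fun x y h => ?_, fun x y hx1 hx2 hy1 hy2 => ?_⟩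
  · rcases Finset.mem_union.1 h with h | h
    · have := p1 x y h; omega
    · have := q1 x y h; omega
  rcases lt_or_ge x k with hx | hx <;> rcases lt_or_ge y k with hy | hy
  · have hxy : (x, y) ∈ p ∪ q ↔ (x, y) ∈ p := by
      rw [Finset.mem_union, or_iff_left]
      intro h; have := q1 x y h; omega
    rw [hxy, p2 x y hx1 hx hy1 hy]
    refine and_congr_right fun _ => forall₂_congr fun u v => ?_
    rw [Finset.mem_union]
    refine ⟨fun h => ?_, fun h h' => h (.inl h')⟩
    rintro (h' | h')
    · exact h h'
    · have := q1 u v h'; omega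
  · refine iff_of_false (fun h => ?_) (cross x y hx1 hx hy hy2)
    rcases Finset.mem_union.1 h with h | h
    · have := p1 x y h; omega
    · have := q1 x y h; omega
  · refine iff_of_false (fun h => ?_) (fun h => cross y x hy1 hy hx hx2 h.symm)
    rcases Finset.mem_union.1 h with h | h
    · have := p1 x y h; omega
    · have := q1 x y h; omega
  · have hxy : (x, y) ∈ p ∪ q ↔ (x, y) ∈ q := by
      rw [Finset.mem_union, or_iff_right]
      intro h; have := p1 x y h; omega
    rw [hxy, q2 x y hx hx2 hy hy2]
    refine and_congr_right fun _ => forall₂_congr fun u v => ?_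
    rw [Finset.mem_union]
    refine ⟨fun h => ?_, fun h h' => h (.inr h')⟩
    rintro (h' | h')
    · have := p1 u v h'; omega
    · exact h h'

/-- A Kreweras pair on an interval with an even number of points splits behind the last point that
is related to the first one. -/
theorem exists_union_of_mem_krewerasPairs {i j : ℕ} {r : Finset (ℕ × ℕ)}
    (hr : r ∈ krewerasPairs i j) (hij : i < j) (heven : (j - i) % 2 = 0) :
    ∃ k, i < k ∧ k < j ∧ (k - i) % 2 = 1 ∧
      ∃ p ∈ krewerasPairs i k, ∃ q ∈ krewerasPairs k j, p ∪ q = r := by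
  classical
  obtain ⟨r1, r2⟩ := mem_krewerasPairs.1 hr
  have hS : ((Finset.Ico i j).filter fun y => (i, y) ∈ r).Nonempty :=
    ⟨i, by simp [hij, krewerasPairs_refl hr le_rfl hij]⟩
  obtain ⟨m, hm, hmax⟩ := Finset.exists_max_image _ id hS
  simp only [Finset.mem_filter, Finset.mem_Ico, id] at hm hmax
  obtain ⟨hm0, him⟩ := hm
  obtain ⟨hpar, hsep⟩ := krewerasPairs_unseparated hr him
  -- A related pair straddling `m` either has the parity of `i`, and then crosses `(i, m)`, which
  -- forces `i ∼ y` against the maximality of `m`; or it has the other parity, and then separates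
  -- `i` from `m`.
  have nocross : ∀ x y, (x, y) ∈ r → x ≤ m → m < y → False := by
    intro x y hxy hxm hmy
    have hb := r1 x y hxy
    obtain ⟨hpar', hsep'⟩ := krewerasPairs_unseparated hr hxy
    by_cases hx : x % 2 = i % 2
    · have hiy : (i, y) ∈ r := by
        refine (r2 i y le_rfl hij (by omega) (by omega)).2 ⟨by omega, fun u v huv hu => ?_⟩
        have h1 := hsep u v huv hu
        have h2 := hsep' u v huv (by omega)
        have h3 := r1 u v huv
        have h4 := (krewerasPairs_unseparated hr huv).1
        omega
      have := hmax y ⟨by omega, hiy⟩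
      omega
    · have := hsep x y hxy hx
      omega
  have nocross' : ∀ x y, (x, y) ∈ r → (x ≤ m ↔ y ≤ m) := by
    intro x y hxy
    exact ⟨fun h => not_lt.1 (nocross x y hxy h),
      fun h => not_lt.1 (nocross y x (krewerasPairs_symm hr hxy) h)⟩
  -- Here `m + 1 < j` because `m` has the parity of `i` and `j - 1` has not.
  refine ⟨m + 1, by omega, by omega, by omega, r.filter fun e => e.1 ≤ m, ?_,
    r.filter fun e => ¬ e.1 ≤ m, ?_, Finset.filter_union_filter_not_eq _ _⟩
  · rw [mem_krewerasPairs]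
    simp only [Finset.mem_filter]
    refine ⟨fun x y h => ?_, fun x y hx1 hx2 hy1 hy2 => ?_⟩
    · have := r1 x y h.1
      have := nocross' x y h.1
      omega
    · rw [and_iff_left (by omega), r2 x y hx1 (by omega) hy1 (by omega)]
      refine and_congr_right fun _ => forall₂_congr fun u v => ?_
      rw [Finset.mem_filter]
      refine ⟨fun h h' => h h'.1, fun h huv => ?_⟩
      by_cases hu : u ≤ m
      · exact h ⟨huv, hu⟩
      · have := nocross' u v huv
        omega
  · rw [mem_krewerasPairs]
    simp only [Finset.mem_filter]
    refine ⟨fun x y h => ?_, fun x y hx1 hx2 hy1 hy2 => ?_⟩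
    · have := r1 x y h.1
      have := nocross' x y h.1
      omega
    · rw [and_iff_left (by omega), r2 x y (by omega) (by omega) (by omega) (by omega)]
      refine and_congr_right fun _ => forall₂_congr fun u v => ?_
      rw [Finset.mem_filter]
      refine ⟨fun h h' => h h'.1, fun h huv => ?_⟩
      by_cases hu : u ≤ m
      · have := nocross' u v huv
        omega
      · exact h ⟨huv, hu⟩

/-- The product over the blocks of `r` in `[i, j)` of the weight `c x` of the cardinality, where `x`
is the last point of the block, and where the last block is counted with `s` additional points. -/
noncomputable def pairsWeight {R : Type*} [CommRing R] (c : ℕ → ℕ → R) (s : ℕ)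
    (r : Finset (ℕ × ℕ)) (i j : ℕ) : R :=
  ∏ x ∈ Finset.Ico i j, if ∀ e ∈ r, e.1 = x → e.2 ≤ x then
    c x ((r.filter fun e => e.1 = x).card + if x + 1 = j then s else 0) else 1

/-- The sum of the weights of the Kreweras pairs on `[i, j)`. -/
noncomputable def pairsSum {R : Type*} [CommRing R] (c : ℕ → ℕ → R) (s i j : ℕ) : R :=
  ∑ r ∈ krewerasPairs i j, pairsWeight c s r i j

section
variable {R : Type*} [CommRing R] (c : ℕ → ℕ → R)

/-- Every block lies in one of the pieces, and the block of `j - 1`, which carries the extra `s`,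
lies in the right one. -/
theorem pairsWeight_union (s : ℕ) {i k j : ℕ} {p q : Finset (ℕ × ℕ)} (hp : p ∈ krewerasPairs i k)
    (hq : q ∈ krewerasPairs k j) (hik : i ≤ k) (hkj : k < j) :
    pairsWeight c s (p ∪ q) i j = pairsWeight c 0 p i k * pairsWeight c s q k j := by
  have p1 := (mem_krewerasPairs.1 hp).1
  have q1 := (mem_krewerasPairs.1 hq).1
  unfold pairsWeight
  rw [← Finset.prod_Ico_consecutive _ hik hkj.le]
  congr 1
  · refine Finset.prod_congr rfl fun x hx => ?_
    rw [Finset.mem_Ico] at hx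
    have hf : (p ∪ q).filter (fun e => e.1 = x) = p.filter fun e => e.1 = x := by
      ext ⟨y, z⟩
      simp only [Finset.mem_filter, Finset.mem_union]
      refine and_congr_left fun h => or_iff_left fun h' => ?_
      have := q1 y z h'
      omega
    have hm : (∀ e ∈ p ∪ q, e.1 = x → e.2 ≤ x) ↔ ∀ e ∈ p, e.1 = x → e.2 ≤ x := by
      refine ⟨fun h e he => h e (Finset.mem_union_left _ he), fun h e he hex => ?_⟩
      rcases Finset.mem_union.1 he with he | he
      · exact h e he hex
      · have := q1 e.1 e.2 he
        omega
    rw [hf, if_neg (by omega : ¬ x + 1 = j), ite_self]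
    simp only [hm]
  · refine Finset.prod_congr rfl fun x hx => ?_
    rw [Finset.mem_Ico] at hx
    have hf : (p ∪ q).filter (fun e => e.1 = x) = q.filter fun e => e.1 = x := by
      ext ⟨y, z⟩
      simp only [Finset.mem_filter, Finset.mem_union]
      refine and_congr_left fun h => or_iff_right fun h' => ?_
      have := p1 y z h'
      omega
    have hm : (∀ e ∈ p ∪ q, e.1 = x → e.2 ≤ x) ↔ ∀ e ∈ q, e.1 = x → e.2 ≤ x := by
      refine ⟨fun h e he => h e (Finset.mem_union_right _ he), fun h e he hex => ?_⟩
      rcases Finset.mem_union.1 he with he | he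
      · have := p1 e.1 e.2 he
        omega
      · exact h e he hex
    rw [hf]
    simp only [hm]

theorem eq_filter_union {i k j : ℕ} {p q : Finset (ℕ × ℕ)} (hp : p ∈ krewerasPairs i k)
    (hq : q ∈ krewerasPairs k j) :
    p = (p ∪ q).filter (fun e => e.1 < k) ∧ q = (p ∪ q).filter fun e => k ≤ e.1 := by
  have p1 := (mem_krewerasPairs.1 hp).1
  have q1 := (mem_krewerasPairs.1 hq).1
  constructor
  · ext ⟨x, y⟩
    simp only [Finset.mem_filter, Finset.mem_union]
    refine ⟨fun h => ⟨.inl h, (p1 x y h).2.1⟩, fun ⟨h, h'⟩ => h.resolve_right fun h2 => ?_⟩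
    have := q1 x y h2
    omega
  · ext ⟨x, y⟩
    simp only [Finset.mem_filter, Finset.mem_union]
    refine ⟨fun h => ⟨.inr h, (q1 x y h).1⟩, fun ⟨h, h'⟩ => h.resolve_left fun h2 => ?_⟩
    have := p1 x y h2
    omega

/-- Splitting of the sum over an interval with an even number of points. -/
theorem pairsSum_even (s i n : ℕ) :
    pairsSum c s i (i + 2 * n + 2) = ∑ m ∈ Finset.range (n + 1),
      pairsSum c 0 i (i + 2 * m + 1) * pairsSum c s (i + 2 * m + 1) (i + 2 * n + 2) := by
  unfold pairsSum
  simp only [Finset.sum_mul_sum, ← Finset.sum_product']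
  rw [Finset.sum_sigma']
  symm
  refine Finset.sum_bij (fun t _ => t.2.1 ∪ t.2.2) ?_ ?_ ?_ ?_
  · rintro ⟨m, p, q⟩ h
    simp only [Finset.mem_sigma, Finset.mem_range, Finset.mem_product] at h
    exact union_mem_krewerasPairs h.2.1 h.2.2 (by omega) (by omega)
  · rintro ⟨m, p, q⟩ h ⟨m', p', q'⟩ h' heq
    simp only [Finset.mem_sigma, Finset.mem_range, Finset.mem_product] at h h' heq
    obtain ⟨hm, hp, hq⟩ := h
    obtain ⟨hm', hp', hq'⟩ := h'
    -- The split point is determined by the union: `i + 2 * m` is the last point related to `i`.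
    have key : ∀ {m m' : ℕ} {p q p' q' : Finset (ℕ × ℕ)}, p ∈ krewerasPairs i (i + 2 * m + 1) →
        p' ∈ krewerasPairs i (i + 2 * m' + 1) →
        q ∈ krewerasPairs (i + 2 * m + 1) (i + 2 * n + 2) →
        p ∪ q = p' ∪ q' → m' ≤ m := by
      intro m m' p q p' q' hp hp' hq heq
      have e := krewerasPairs_ends hp' (by omega)
      have e' : (i, i + 2 * m' + 1 - 1) ∈ p ∪ q := by
        rw [heq]; exact Finset.mem_union_left _ e
      rcases Finset.mem_union.1 e' with h | h
      · have := (mem_krewerasPairs.1 hp).1 _ _ h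
        omega
      · have := (mem_krewerasPairs.1 hq).1 _ _ h
        omega
    obtain rfl : m = m' := le_antisymm (key hp' hp hq' heq.symm) (key hp hp' hq heq)
    have h1 := eq_filter_union hp hq
    have h2 := eq_filter_union hp' hq'
    rw [← heq] at h2
    rw [h1.1.trans h2.1.symm, h1.2.trans h2.2.symm]
  · intro r hr
    obtain ⟨k, h1, h2, h3, p, hp, q, hq, rfl⟩ :=
      exists_union_of_mem_krewerasPairs hr (by omega) (by omega)
    obtain ⟨m, rfl⟩ : ∃ m, k = i + 2 * m + 1 := ⟨(k - i) / 2, by omega⟩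
    exact ⟨⟨m, p, q⟩, by simp only [Finset.mem_sigma, Finset.mem_range, Finset.mem_product]
                         exact ⟨by omega, hp, hq⟩, rfl⟩
  · rintro ⟨m, p, q⟩ h
    simp only [Finset.mem_sigma, Finset.mem_range, Finset.mem_product] at h
    exact (pairsWeight_union c s h.2.1 h.2.2 (by omega) (by omega)).symm

theorem krewerasPairs_singleton (i : ℕ) : krewerasPairs i (i + 1) = {{(i, i)}} := by
  ext r
  rw [mem_krewerasPairs, Finset.mem_singleton]
  constructor
  · rintro ⟨h1, h2⟩
    ext ⟨x, y⟩
    rw [Finset.mem_singleton, Prod.mk.injEq]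
    constructor
    · intro h
      have := h1 x y h
      omega
    · rintro ⟨rfl, rfl⟩
      exact (h2 _ _ le_rfl (by omega) le_rfl (by omega)).2 (.refl _ _)
  · rintro rfl
    simp only [Finset.mem_singleton, Prod.mk.injEq]
    refine ⟨by omega, fun x y h1 h2 h3 h4 => ?_⟩
    obtain rfl : x = i := by omega
    obtain rfl : y = x := by omega
    exact iff_of_true ⟨rfl, rfl⟩ (.refl _ _)

theorem pairsSum_singleton (s i : ℕ) : pairsSum c s i (i + 1) = c i (1 + s) := by
  simp [pairsSum, pairsWeight, krewerasPairs_singleton, Finset.filter_singleton]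

/-! ### Removing the first point of an interval with an odd number of points. -/

/-- Extend a relation by a new point `i`, which joins the block of `l`. -/
noncomputable def joinPoint (i l : ℕ) (p : Finset (ℕ × ℕ)) : Finset (ℕ × ℕ) :=
  p ∪ ({(i, i)} ∪ ((p.filter fun e => e.1 = l).image (fun e => (i, e.2)) ∪
    (p.filter fun e => e.2 = l).image fun e => (e.1, i)))

theorem mem_joinPoint {i l : ℕ} {p : Finset (ℕ × ℕ)} {x y : ℕ} :
    (x, y) ∈ joinPoint i l p ↔
      (x, y) ∈ p ∨ (x = i ∧ y = i) ∨ (x = i ∧ (l, y) ∈ p) ∨ (y = i ∧ (x, l) ∈ p) := by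
  unfold joinPoint
  simp only [Finset.mem_union, Finset.mem_singleton, Prod.mk.injEq, Finset.mem_image,
    Finset.mem_filter, Prod.exists]
  constructor
  · rintro (h | h | ⟨a, b, ⟨h, rfl⟩, rfl, rfl⟩ | ⟨a, b, ⟨h, rfl⟩, rfl, rfl⟩) <;> simp_all
  · rintro (h | h | ⟨rfl, h⟩ | ⟨rfl, h⟩)
    · exact .inl h
    · exact .inr (.inl h)
    · exact .inr (.inr (.inl ⟨l, y, ⟨h, rfl⟩, rfl, rfl⟩))
    · exact .inr (.inr (.inr ⟨x, l, ⟨h, rfl⟩, rfl, rfl⟩))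

section
variable {i j : ℕ} {p : Finset (ℕ × ℕ)}

theorem mem_joinPoint_of_ne {x y : ℕ} (hx : x ≠ i)
    (hy : y ≠ i) : (x, y) ∈ joinPoint i (j - 1) p ↔ (x, y) ∈ p := by
  simp [mem_joinPoint, hx, hy]

theorem mem_joinPoint_left (hp : p ∈ krewerasPairs (i + 1) j) {y : ℕ} (hy : y ≠ i) :
    (i, y) ∈ joinPoint i (j - 1) p ↔ (j - 1, y) ∈ p := by
  have : ∀ y, (i, y) ∉ p := fun y h => by
    have := (mem_krewerasPairs.1 hp).1 _ _ h
    omega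
  simp [mem_joinPoint, hy, this]

theorem mem_joinPoint_right (hp : p ∈ krewerasPairs (i + 1) j) {x : ℕ} (hx : x ≠ i) :
    (x, i) ∈ joinPoint i (j - 1) p ↔ (x, j - 1) ∈ p := by
  have : ∀ x, (x, i) ∉ p := fun x h => by
    have := (mem_krewerasPairs.1 hp).1 _ _ h
    omega
  simp [mem_joinPoint, hx, this]

/-- The ends `i` and `j - 1` have equal parity and all points of the other parity lie between them.
So `i, y` and `y, j - 1` cut those points into the same two sets, and a pair containing `i`
separates the same points as the pair with `j - 1` in its place. -/
theorem joinPoint_mem (hp : p ∈ krewerasPairs (i + 1) j) (hij : (j - i) % 2 = 1)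
    (h3 : i + 3 ≤ j) : joinPoint i (j - 1) p ∈ krewerasPairs i j := by
  obtain ⟨p1, p2⟩ := mem_krewerasPairs.1 hp
  have hii : (i, i) ∈ joinPoint i (j - 1) p := mem_joinPoint.2 (by simp)
  have sep : ∀ x y, i < x → x < j → i < y → y < j →
      (Unseparated (joinPoint i (j - 1) p) x y ↔ Unseparated p x y) := by
    intro x y hx1 hx2 hy1 hy2
    refine and_congr_right fun hxy => ?_
    constructor
    · intro h u v huv
      refine h u v ?_
      have := p1 u v huv
      rwa [mem_joinPoint_of_ne (by omega) (by omega)]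
    · intro h u v huv hu
      by_cases hui : u = i
      · subst hui
        by_cases hvi : v = u
        · subst hvi; simp
        · rw [mem_joinPoint_left hp hvi] at huv
          have := h _ _ huv (by omega)
          have := p1 _ _ huv
          omega
      · by_cases hvi : v = i
        · subst hvi
          rw [mem_joinPoint_right hp hui] at huv
          have h4 := (krewerasPairs_unseparated hp huv).1
          have := h _ _ huv (by omega)
          have := p1 _ _ huv
          omega
        · rw [mem_joinPoint_of_ne hui hvi] at huv
          exact h u v huv hu
  have sepi : ∀ y, i < y → y < j →
      (Unseparated (joinPoint i (j - 1) p) i y ↔ (j - 1, y) ∈ p) := by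
    intro y hy1 hy2
    rw [p2 _ _ (by omega) (by omega) hy1 hy2]
    constructor
    · rintro ⟨h1, h2⟩
      refine ⟨by omega, fun u v huv hu => ?_⟩
      have h4 := (krewerasPairs_unseparated hp huv).1
      have h5 := p1 u v huv
      have := h2 u v ((mem_joinPoint_of_ne (by omega) (by omega)).2 huv) (by omega)
      omega
    · rintro ⟨h1, h2⟩
      refine ⟨by omega, fun u v huv hu => ?_⟩
      by_cases hvi : v = i
      · subst hvi
        rw [mem_joinPoint_right hp (by rintro rfl; exact hu rfl)] at huv
        have h4 := (krewerasPairs_unseparated hp huv).1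
        omega
      · rw [mem_joinPoint_of_ne (by rintro rfl; exact hu rfl) hvi] at huv
        have h4 := (krewerasPairs_unseparated hp huv).1
        have h5 := p1 u v huv
        have := h2 u v huv (by omega)
        omega
  rw [mem_krewerasPairs]
  constructor
  · intro x y h
    rw [mem_joinPoint] at h
    rcases h with h | h | ⟨h, h'⟩ | ⟨h, h'⟩
    · have := p1 _ _ h; omega
    · omega
    · have := p1 _ _ h'; omega
    · have := p1 _ _ h'; omega
  · intro x y hx1 hx2 hy1 hy2
    by_cases hx : x = i
    · subst hx
      by_cases hy : y = x
      · subst hy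
        exact iff_of_true hii (.refl _ _)
      · rw [mem_joinPoint_left hp hy, sepi y (by omega) hy2]
    · by_cases hy : y = i
      · subst hy
        rw [mem_joinPoint_right hp hx]
        exact ⟨fun h => ((sepi x (by omega) hx2).2 (krewerasPairs_symm hp h)).symm,
          fun h => krewerasPairs_symm hp ((sepi x (by omega) hx2).1 h.symm)⟩
      · rw [mem_joinPoint_of_ne hx hy, p2 x y (by omega) hx2 (by omega) hy2,
          sep x y (by omega) hx2 (by omega) hy2]

/-- Deleting `i` loses nothing, since `i ∼ j - 1` and every pair containing `i` can be replaced by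
one containing `j - 1`. -/
theorem exists_joinPoint_eq {r : Finset (ℕ × ℕ)} (hr : r ∈ krewerasPairs i j)
    (hij : (j - i) % 2 = 1) (h3 : i + 3 ≤ j) :
    ∃ p ∈ krewerasPairs (i + 1) j, joinPoint i (j - 1) p = r := by
  obtain ⟨r1, r2⟩ := mem_krewerasPairs.1 hr
  have hends := krewerasPairs_ends hr hij
  have hp : (r.filter fun e => e.1 ≠ i ∧ e.2 ≠ i) ∈ krewerasPairs (i + 1) j := by
    rw [mem_krewerasPairs]
    simp only [Finset.mem_filter]
    refine ⟨fun x y h => ?_, fun x y hx1 hx2 hy1 hy2 => ?_⟩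
    · have := r1 x y h.1
      omega
    · rw [and_iff_left (by omega), r2 x y (by omega) hx2 (by omega) hy2]
      refine and_congr_right fun hxy => ?_
      constructor
      · intro h u v huv
        exact h u v (Finset.mem_filter.1 huv).1
      · intro h u v huv hu
        by_cases hui : u = i
        · by_cases hvi : v = i
          · subst hui hvi; simp
          · have h6 : (j - 1, v) ∈ r := by
              rw [hui] at huv
              exact krewerasPairs_trans hr (krewerasPairs_symm hr hends) huv
            have h7 := (krewerasPairs_unseparated hr h6).1
            have := r1 _ _ h6
            have := h (j - 1) v (by simp only [Finset.mem_filter]; exact ⟨h6, by omega⟩) (by omega)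
            omega
        · by_cases hvi : v = i
          · have h6 : (u, j - 1) ∈ r := by
              rw [hvi] at huv
              exact krewerasPairs_trans hr huv hends
            have h7 := (krewerasPairs_unseparated hr h6).1
            have := r1 _ _ h6
            have := h u (j - 1) (by simp only [Finset.mem_filter]; exact ⟨h6, by omega⟩) (by omega)
            omega
          · exact h u v (by simp only [Finset.mem_filter]; exact ⟨huv, hui, hvi⟩) hu
  refine ⟨_, hp, ?_⟩
  ext ⟨x, y⟩
  by_cases hx : x = i
  · subst hx
    by_cases hy : y = x
    · subst hy
      exact iff_of_true (mem_joinPoint.2 (by simp)) (krewerasPairs_refl hr le_rfl (by omega))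
    · rw [mem_joinPoint_left hp hy, Finset.mem_filter, and_iff_left ⟨by simp; omega, hy⟩]
      exact ⟨fun h => krewerasPairs_trans hr hends h,
        fun h => krewerasPairs_trans hr (krewerasPairs_symm hr hends) h⟩
  · by_cases hy : y = i
    · subst hy
      rw [mem_joinPoint_right hp hx, Finset.mem_filter, and_iff_left ⟨hx, by simp; omega⟩]
      exact ⟨fun h => krewerasPairs_trans hr h (krewerasPairs_symm hr hends),
        fun h => krewerasPairs_trans hr h hends⟩
    · rw [mem_joinPoint_of_ne hx hy, Finset.mem_filter, and_iff_left ⟨hx, hy⟩]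

theorem pairsWeight_joinPoint (s : ℕ) (hp : p ∈ krewerasPairs (i + 1) j) (h3 : i + 3 ≤ j) :
    pairsWeight c s (joinPoint i (j - 1) p) i j = pairsWeight c (s + 1) p (i + 1) j := by
  obtain ⟨p1, p2⟩ := mem_krewerasPairs.1 hp
  have hend : (j - 1, j - 1) ∈ p := krewerasPairs_refl hp (by omega) (by omega)
  unfold pairsWeight
  -- The point `i` is not the last of its block, which contains `j - 1`, so its factor is `1`.
  rw [Finset.prod_eq_prod_Ico_succ_bot (by omega), if_neg, one_mul]
  · refine Finset.prod_congr rfl fun x hx => ?_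
    rw [Finset.mem_Ico] at hx
    have hm : (∀ e ∈ joinPoint i (j - 1) p, e.1 = x → e.2 ≤ x) ↔ ∀ e ∈ p, e.1 = x → e.2 ≤ x := by
      constructor
      · intro h e he
        exact h e (mem_joinPoint.2 (.inl he))
      · rintro h ⟨y, z⟩ he rfl
        by_cases hz : z = i
        · simp only; omega
        · rw [mem_joinPoint_of_ne (by simp only at hx; omega) hz] at he
          exact h _ he rfl
    simp only [hm]
    by_cases hxj : x + 1 = j
    · have hf : (joinPoint i (j - 1) p).filter (fun e => e.1 = x) =
          insert (x, i) (p.filter fun e => e.1 = x) := by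
        ext ⟨y, z⟩
        simp only [Finset.mem_filter, Finset.mem_insert, Prod.mk.injEq]
        by_cases hz : z = i
        · subst hz
          have : ∀ y, (y, z) ∉ p := fun y h => by have := p1 _ _ h; omega
          simp only [this, false_and, or_false, and_true]
          refine ⟨fun h => h.2, ?_⟩
          rintro rfl
          refine ⟨(mem_joinPoint_right hp (by omega)).2 ?_, rfl⟩
          obtain rfl : y = j - 1 := by omega
          exact hend
        · simp only [hz, and_false, false_or]
          refine and_congr_left fun h => ?_
          rw [mem_joinPoint_of_ne (by omega) hz]
      rw [hf, Finset.card_insert_of_notMem, if_pos hxj, if_pos hxj, add_assoc, add_comm 1 s]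
      intro h
      have := p1 _ _ (Finset.mem_filter.1 h).1
      omega
    · rw [if_neg hxj, if_neg hxj]
      -- If `x ≠ j - 1` is the last point of its block, this block does not contain `j - 1` and
      -- hence is not joined by `i`.
      by_cases hmax : ∀ e ∈ p, e.1 = x → e.2 ≤ x
      · have hf : (joinPoint i (j - 1) p).filter (fun e => e.1 = x) =
            p.filter fun e => e.1 = x := by
          ext ⟨y, z⟩
          simp only [Finset.mem_filter]
          refine and_congr_left fun h => ?_
          subst h
          by_cases hz : z = i
          · subst hz
            rw [mem_joinPoint_right hp (by omega)]
            refine iff_of_false (fun h => ?_) (fun h => by have := p1 _ _ h; omega)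
            have := hmax _ h rfl
            simp only at this
            omega
          · rw [mem_joinPoint_of_ne (by omega) hz]
        rw [hf, add_zero]
      · rw [if_neg hmax, if_neg hmax]
  · intro h
    have := h (i, j - 1) (mem_joinPoint.2 (by simp [hend])) rfl
    simp only at this
    omega

end

/-- Removing the first point of an interval with an odd number of points. -/
theorem pairsSum_odd (s i n : ℕ) :
    pairsSum c s i (i + 2 * n + 3) = pairsSum c (s + 1) (i + 1) (i + 1 + 2 * n + 2) := by
  have hj : i + 1 + 2 * n + 2 = i + 2 * n + 3 := by ring
  rw [hj]
  symm
  refine Finset.sum_bij (fun p _ => joinPoint i (i + 2 * n + 3 - 1) p) ?_ ?_ ?_ ?_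
  · intro p hp
    exact joinPoint_mem hp (by omega) (by omega)
  · intro p hp q hq h
    have key : ∀ {p q : Finset (ℕ × ℕ)}, p ∈ krewerasPairs (i + 1) (i + 2 * n + 3) →
        q ∈ krewerasPairs (i + 1) (i + 2 * n + 3) →
        joinPoint i (i + 2 * n + 3 - 1) p = joinPoint i (i + 2 * n + 3 - 1) q → p ⊆ q := by
      rintro p q hp hq h ⟨x, y⟩ hxy
      have := (mem_krewerasPairs.1 hp).1 x y hxy
      rw [← mem_joinPoint_of_ne (i := i) (j := i + 2 * n + 3) (by omega) (by omega), ← h]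
      exact mem_joinPoint.2 (.inl hxy)
    exact (key hp hq h).antisymm (key hq hp h.symm)
  · intro r hr
    obtain ⟨p, hp, h⟩ := exists_joinPoint_eq hr (by omega) (by omega)
    exact ⟨p, hp, h⟩
  · intro p hp
    exact (pairsWeight_joinPoint c s hp (by omega)).symm

end

/-! ### Generating functions and their functional equations. -/

section
variable {R : Type*} [CommRing R] {c : ℕ → ℕ → R}

/-- Both recurrences and the one-point case see the position only through `c`, which has period two;
no translation of relations is needed. -/
theorem pairsSum_add_two (hc : ∀ x, c (x + 2) = c x) (s i l : ℕ) :
    pairsSum c s (i + 2) (i + 2 + l + 1) = pairsSum c s i (i + l + 1) := by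
  induction l using Nat.strong_induction_on generalizing s i with
  | _ l ih =>
    rcases Nat.even_or_odd' l with ⟨n, rfl | rfl⟩
    · cases n with
      | zero => rw [mul_zero, add_zero, pairsSum_singleton, add_zero, pairsSum_singleton, hc]
      | succ n =>
        have h1 := pairsSum_odd c s (i + 2) n
        have h2 := pairsSum_odd c s i n
        have h3 := ih (2 * n + 1) (by omega) (s + 1) (i + 1)
        rw [show i + 2 + 2 * (n + 1) + 1 = i + 2 + 2 * n + 3 by ring,
          show i + 2 * (n + 1) + 1 = i + 2 * n + 3 by ring, h1, h2]
        convert h3 using 2 <;> ring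
    · have h1 := pairsSum_even c s (i + 2) n
      have h2 := pairsSum_even c s i n
      rw [show i + 2 + (2 * n + 1) + 1 = i + 2 + 2 * n + 2 by ring,
        show i + (2 * n + 1) + 1 = i + 2 * n + 2 by ring, h1, h2]
      refine Finset.sum_congr rfl fun m hm => ?_
      rw [Finset.mem_range] at hm
      have h3 := ih (2 * m) (by omega) 0 i
      have h4 := ih (2 * (n - m)) (by omega) s (i + 2 * m + 1)
      rw [h3]
      congr 1
      convert h4 using 2 <;> omega

theorem pairsSum_add_two_mul (hc : ∀ x, c (x + 2) = c x) (s i m l : ℕ) :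
    pairsSum c s (i + 2 * m) (i + 2 * m + l + 1) = pairsSum c s i (i + l + 1) := by
  induction m with
  | zero => simp
  | succ m ih => rw [← ih, ← pairsSum_add_two hc s (i + 2 * m), mul_add_one, ← add_assoc]

/-- The generating function of the sums over the intervals with an odd number of points. -/
noncomputable def oddSeries (c : ℕ → ℕ → R) (s i : ℕ) : R⟦X⟧ :=
  PowerSeries.mk fun n => pairsSum c s i (i + 2 * n + 1)

/-- The generating function of the sums over the intervals with an even number of points. -/
noncomputable def evenSeries (c : ℕ → ℕ → R) (s i : ℕ) : R⟦X⟧ :=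
  PowerSeries.mk fun n => pairsSum c s i (i + 2 * n + 2)

theorem oddSeries_add_two (hc : ∀ x, c (x + 2) = c x) (s i : ℕ) :
    oddSeries c s (i + 2) = oddSeries c s i := by
  ext n
  simp only [oddSeries, PowerSeries.coeff_mk]
  exact pairsSum_add_two hc s i (2 * n)

/-- This is `pairsSum_even` read as a Cauchy product, after the right interval has been shifted back
to start at `i + 1`. -/
theorem evenSeries_eq_mul (hc : ∀ x, c (x + 2) = c x) (s i : ℕ) :
    evenSeries c s i = oddSeries c 0 i * oddSeries c s (i + 1) := by
  ext n
  simp only [oddSeries, evenSeries, PowerSeries.coeff_mk, PowerSeries.coeff_mul]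
  rw [pairsSum_even, Finset.Nat.sum_antidiagonal_eq_sum_range_succ
    fun m l => pairsSum c 0 i (i + 2 * m + 1) * pairsSum c s (i + 1) (i + 1 + 2 * l + 1)]
  refine Finset.sum_congr rfl fun m hm => ?_
  rw [Finset.mem_range] at hm
  rw [← pairsSum_add_two_mul hc s (i + 1) m]
  congr 2 <;> omega

/-- The constant term comes from the one-point interval. Otherwise the removal of a point turns `2 *
n + 3` points into `2 * n + 2`, which lowers the index by one: hence the factor `X`. -/
theorem oddSeries_eq_add (c : ℕ → ℕ → R) (s i : ℕ) :
    oddSeries c s i =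
      PowerSeries.C (c i (1 + s)) + PowerSeries.X * evenSeries c (s + 1) (i + 1) := by
  ext n
  cases n with
  | zero => simp [oddSeries, pairsSum_singleton]
  | succ n =>
    simp only [map_add, PowerSeries.coeff_succ_X_mul, PowerSeries.coeff_C,
      oddSeries, evenSeries, PowerSeries.coeff_mk]
    rw [if_neg (Nat.succ_ne_zero n), zero_add, ← pairsSum_odd]
    rfl

/-- Iteration of `O_s(i) = c i (1 + s) + X O_0(i + 1) O_{s+1}(i)`, where `O` stands for `oddSeries
c`; the remainder has order at least `m`. -/
theorem oddSeries_eq_sum (hc : ∀ x, c (x + 2) = c x) (i m : ℕ) :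
    oddSeries c 0 i =
      ∑ k ∈ Finset.range m,
        PowerSeries.C (c i (k + 1)) * (PowerSeries.X * oddSeries c 0 (i + 1)) ^ k +
      (PowerSeries.X * oddSeries c 0 (i + 1)) ^ m * oddSeries c m i := by
  induction m with
  | zero => simp
  | succ m ih =>
    rw [ih, Finset.sum_range_succ, add_assoc]
    congr 1
    rw [oddSeries_eq_add c m i, evenSeries_eq_mul hc, oddSeries_add_two hc, add_comm 1 m]
    ring

theorem subst_oddSeries (hc : ∀ x, c (x + 2) = c x) (i : ℕ) {f : R⟦X⟧}
    (hf : PowerSeries.constantCoeff f = 0) (hcf : ∀ k, c i k = PowerSeries.coeff k f) :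
    PowerSeries.subst (PowerSeries.X * oddSeries c 0 (i + 1)) f =
      PowerSeries.X * oddSeries c 0 (i + 1) * oddSeries c 0 i := by
  set P := PowerSeries.X * oddSeries c 0 (i + 1) with hP
  have hvan : ∀ n d (u : R⟦X⟧), n < d → PowerSeries.coeff n (P ^ d * u) = 0 := by
    intro n d u h
    rw [hP, mul_pow, mul_assoc, PowerSeries.coeff_X_pow_mul', if_neg (by omega)]
  ext n
  -- Only the powers `P ^ d` with `d ≤ n` reach the coefficient `n`. The expansion of `oddSeries c 0
  -- i` is cut at `m = n`, so that after multiplication by `P` the remainder is divisible by `P ^ (n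
  -- + 1)`.
  rw [PowerSeries.coeff_subst' (PowerSeries.HasSubst.of_constantCoeff_zero' (by simp [P])),
    finsum_eq_sum_of_support_subset (s := Finset.range (n + 1)), Finset.sum_range_succ',
    PowerSeries.coeff_zero_eq_constantCoeff_apply, hf, zero_smul, add_zero,
    oddSeries_eq_sum hc i n, ← hP, mul_add, map_add, Finset.mul_sum, map_sum,
    ← mul_assoc, ← pow_succ', hvan _ _ _ (Nat.lt_succ_self n), add_zero]
  · refine Finset.sum_congr rfl fun k _ => ?_
    rw [hcf, mul_left_comm, PowerSeries.coeff_C_mul, ← pow_succ', smul_eq_mul]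
  · intro d hd
    by_contra hcon
    simp only [Finset.coe_range, Set.mem_Iio, not_lt] at hcon
    apply hd
    have := hvan n d 1 (by omega)
    rw [mul_one] at this
    simp only [this, smul_zero]

end

/-! ### Noncrossing partitions as self-dual relations. -/

section
variable {n : ℕ}

theorem mem_part_iff_blockRel (π : Finpartition (Finset.univ : Finset (Fin n))) {i j : Fin n} :
    j ∈ π.part i ↔ blockRel π i j := by
  rw [Finpartition.mem_part_iff_part_eq_part _ (Finset.mem_univ j) (Finset.mem_univ i)]
  exact eq_comm

theorem blockRel_injective {π π' : Finpartition (Finset.univ : Finset (Fin n))}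
    (h : ∀ i j, blockRel π i j → blockRel π' i j) (h' : ∀ i j, blockRel π' i j → blockRel π i j) :
    π = π' := by
  have hpart : ∀ i, π.part i = π'.part i := fun i => by
    ext j
    rw [mem_part_iff_blockRel, mem_part_iff_blockRel]
    exact ⟨h i j, h' i j⟩
  apply Finpartition.ext
  ext V
  constructor
  · intro hV
    obtain ⟨i, hi⟩ := π.nonempty_of_mem_parts hV
    rw [← π.part_eq_of_mem hV hi, hpart i]
    simp
  · intro hV
    obtain ⟨i, hi⟩ := π'.nonempty_of_mem_parts hV
    rw [← π'.part_eq_of_mem hV hi, ← hpart i]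
    simp

open Classical in
/-- The product over the blocks, written as a product over the last points of the blocks. -/
theorem partitionCoeff_eq_prod {R : Type*} [CommRing R] (f : R⟦X⟧) (π : NCPartition n) :
    partitionCoeff f π = ∏ i : Fin n, if ∀ j, blockRel π.1 i j → j ≤ i then
      PowerSeries.coeff (Finset.univ.filter fun j => blockRel π.1 i j).card f else 1 := by
  rw [← Finset.prod_filter]
  unfold partitionCoeff
  symm
  refine Finset.prod_bij (fun i _ => π.1.part i) ?_ ?_ ?_ ?_
  · intro i _
    simp
  · intro i hi j hj h
    simp only [Finset.mem_filter, Finset.mem_univ, true_and] at hi hj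
    exact le_antisymm (hj i h.symm) (hi j h)
  · intro V hV
    have hne := π.1.nonempty_of_mem_parts hV
    have hp := π.1.part_eq_of_mem hV (V.max'_mem hne)
    refine ⟨V.max' hne, ?_, hp⟩
    simp only [Finset.mem_filter, Finset.mem_univ, true_and]
    intro j hj
    apply V.le_max'
    rw [← hp, mem_part_iff_blockRel]
    exact hj
  · intro i _
    have hi : π.1.part i = Finset.univ.filter fun j => blockRel π.1 i j := by
      ext j
      simp [mem_part_iff_blockRel]
    rw [hi]

open Classical in
/-- The partition `π` on the even points together with its Kreweras complement on the odd points. -/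
noncomputable def interleavedPairs (π : Finpartition (Finset.univ : Finset (Fin n))) :
    Finset (ℕ × ℕ) :=
  (Finset.univ.filter fun e : Fin n × Fin n => blockRel π e.1 e.2).image
      (fun e => (2 * (e.1 : ℕ), 2 * (e.2 : ℕ))) ∪
    (Finset.univ.filter fun e : Fin n × Fin n => krewerasRel π e.1 e.2).image
      fun e => (2 * (e.1 : ℕ) + 1, 2 * (e.2 : ℕ) + 1)

theorem mem_interleavedPairs {π : Finpartition (Finset.univ : Finset (Fin n))} {x y : ℕ} :
    (x, y) ∈ interleavedPairs π ↔
      (∃ i j : Fin n, blockRel π i j ∧ 2 * (i : ℕ) = x ∧ 2 * (j : ℕ) = y) ∨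
        ∃ i j : Fin n, krewerasRel π i j ∧ 2 * (i : ℕ) + 1 = x ∧ 2 * (j : ℕ) + 1 = y := by
  simp [interleavedPairs]

theorem even_mem_interleavedPairs {π : Finpartition (Finset.univ : Finset (Fin n))} {i j : Fin n} :
    (2 * (i : ℕ), 2 * (j : ℕ)) ∈ interleavedPairs π ↔ blockRel π i j := by
  rw [mem_interleavedPairs]
  constructor
  · rintro (⟨a, b, h, h1, h2⟩ | ⟨a, b, h, h1, h2⟩)
    · obtain rfl : a = i := by omega
      obtain rfl : b = j := by omega
      exact h
    · omega
  · exact fun h => .inl ⟨i, j, h, rfl, rfl⟩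

theorem odd_mem_interleavedPairs {π : Finpartition (Finset.univ : Finset (Fin n))} {i j : Fin n} :
    (2 * (i : ℕ) + 1, 2 * (j : ℕ) + 1) ∈ interleavedPairs π ↔ krewerasRel π i j := by
  rw [mem_interleavedPairs]
  constructor
  · rintro (⟨a, b, h, h1, h2⟩ | ⟨a, b, h, h1, h2⟩)
    · omega
    · obtain rfl : a = i := by omega
      obtain rfl : b = j := by omega
      exact h
  · exact fun h => .inr ⟨i, j, h, rfl, rfl⟩

/-- Points in different blocks of a noncrossing partition are separated by a block of the Kreweras
complement. -/
theorem exists_krewerasRel_separating {π : Finpartition (Finset.univ : Finset (Fin n))}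
    (hπ : IsNoncrossing (blockRel π)) {i j : Fin n} (hij : i < j) (h : ¬ blockRel π i j) :
    ∃ a b, krewerasRel π a b ∧ ¬ ((a < i ↔ b < i) ↔ (a < j ↔ b < j)) := by
  classical
  have hs : ∀ {a b}, blockRel π a b → blockRel π b a := (blockRel π).symm
  have ht : ∀ {a b c}, blockRel π a b → blockRel π b c → blockRel π a c := (blockRel π).trans
  obtain ⟨m, hm, hmax⟩ := Finset.exists_max_image
    (Finset.univ.filter fun a => blockRel π i a ∧ a < j) id ⟨i, by simp [hij]⟩
  simp only [Finset.mem_filter, Finset.mem_univ, true_and, id] at hm hmax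
  have him : i ≤ m := hmax i ⟨(blockRel π).refl i, hij⟩
  -- Either the block of `i` continues beyond `j`, and `j` lies in the gap between consecutive
  -- points `m` and `w` of the block, or `m` is its last point.
  by_cases hw : (Finset.univ.filter fun a => blockRel π i a ∧ j < a).Nonempty
  · obtain ⟨w, hw, hmin⟩ := Finset.exists_min_image _ id hw
    simp only [Finset.mem_filter, Finset.mem_univ, true_and, id] at hw hmin
    have hmw : blockRel π m w := ht (hs hm.1) hw.1
    have between : ∀ a, m < a → a < w → ¬ blockRel π i a := by
      intro a h1 h2 h3
      rcases lt_trichotomy a j with h4 | h4 | h4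
      · exact absurd (hmax a ⟨h3, h4⟩) (not_le.2 h1)
      · exact h (h4 ▸ h3)
      · exact absurd (hmin a ⟨h3, h4⟩) (not_le.2 h2)
    have closed : ∀ a b, blockRel π a b → m < a → a < w → m < b ∧ b < w := by
      intro a b hab h1 h2
      have hna := between a h1 h2
      constructor
      · rcases lt_trichotomy m b with h3 | h3 | h3
        · exact h3
        · exact absurd (ht hm.1 (h3 ▸ hs hab)) hna
        · exact absurd (ht hm.1 (ht (hs (hπ b m a w h3 h1 h2 (hs hab) hmw)) (hs hab))) hna
      · rcases lt_trichotomy b w with h3 | h3 | h3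
        · exact h3
        · exact absurd (ht hw.1 (h3 ▸ hs hab)) hna
        · exact absurd (ht hm.1 (hπ m a w b h1 h2 h3 hmw hab)) hna
    -- The gap `m < a ≤ w - 1` is a union of blocks that contains `j` but not `i`.
    refine ⟨m, ⟨w - 1, by omega⟩, fun a b hab => ?_, ?_⟩
    · have h1 := closed a b hab
      have h2 := closed b a (hs hab)
      simp only [Fin.lt_def] at *
      omega
    · simp only [Fin.lt_def, Fin.le_def] at *
      omega
  · have hle : ∀ a, blockRel π i a → a ≤ m := by
      intro a ha
      refine hmax a ⟨ha, ?_⟩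
      rcases lt_trichotomy a j with h4 | h4 | h4
      · exact h4
      · exact absurd (h4 ▸ ha) h
      · exact absurd ⟨a, by simp [ha, h4]⟩ hw
    obtain ⟨f, hf, hmin⟩ := Finset.exists_min_image
      (Finset.univ.filter fun a => blockRel π i a) id ⟨i, by simp⟩
    simp only [Finset.mem_filter, Finset.mem_univ, true_and, id] at hf hmin
    have hfi : f ≤ i := hmin i ((blockRel π).refl i)
    have closed : ∀ a b, blockRel π a b → f ≤ a → a ≤ m → f ≤ b ∧ b ≤ m := by
      intro a b hab h1 h2
      by_cases ha : blockRel π i a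
      · exact ⟨hmin b (ht ha hab), hle b (ht ha hab)⟩
      have hfa : f < a := lt_of_le_of_ne h1 (by rintro rfl; exact ha hf)
      have ham : a < m := lt_of_le_of_ne h2 (by rintro rfl; exact ha hm.1)
      have hfm : blockRel π f m := ht (hs hf) hm.1
      constructor
      · by_contra h3
        exact h3 (hmin b (ht hf (hs (hπ b f a m (not_le.1 h3) hfa ham (hs hab) hfm))))
      · by_contra h3
        exact ha (ht hf (hπ f a m b hfa ham (not_le.1 h3) hfm hab))
    -- The hull `f ≤ a ≤ m` of the block is a union of blocks that contains `i` but not `j`. It is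
    -- cut off by `f - 1` and `m`; if `f = 0` there is no point `f - 1`, and the complement, cut off
    -- by `m` and `n - 1`, serves instead.
    by_cases hf0 : (f : ℕ) = 0
    · refine ⟨m, ⟨n - 1, by omega⟩, fun a b hab => ?_, ?_⟩
      · have h1 := closed a b hab
        have h2 := closed b a (hs hab)
        simp only [Fin.lt_def, Fin.le_def] at *
        omega
      · simp only [Fin.lt_def, Fin.le_def] at *
        omega
    · refine ⟨⟨f - 1, by omega⟩, m, fun a b hab => ?_, ?_⟩
      · have h1 := closed a b hab
        have h2 := closed b a (hs hab)
        simp only [Fin.lt_def, Fin.le_def] at *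
        omega
      · simp only [Fin.lt_def, Fin.le_def] at *
        omega

/-- On the odd points the condition is the definition of `krewerasRel`. On the even points it says
that `π` can be recovered from its complement, which is where noncrossing enters. -/
theorem interleavedPairs_mem {π : Finpartition (Finset.univ : Finset (Fin n))}
    (hπ : IsNoncrossing (blockRel π)) : interleavedPairs π ∈ krewerasPairs 0 (2 * n) := by
  have lt_case : ∀ i j : Fin n, i < j →
      Unseparated (interleavedPairs π) (2 * (i : ℕ)) (2 * (j : ℕ)) → blockRel π i j := by
    intro i j hij h
    by_contra hcon
    obtain ⟨a, b, hab, hsep⟩ := exists_krewerasRel_separating hπ hij hcon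
    apply hsep
    have := h.2 _ _ (odd_mem_interleavedPairs.2 hab) (by omega)
    simp only [Fin.lt_def]
    omega
  rw [mem_krewerasPairs]
  refine ⟨fun x y h => ?_, fun x y _ hx _ hy => ?_⟩
  · rcases mem_interleavedPairs.1 h with ⟨i, j, -, h1, h2⟩ | ⟨i, j, -, h1, h2⟩ <;> omega
  rcases Nat.even_or_odd' x with ⟨i, rfl | rfl⟩ <;> rcases Nat.even_or_odd' y with ⟨j, rfl | rfl⟩
  · obtain ⟨i, rfl⟩ : ∃ k : Fin n, (k : ℕ) = i := ⟨⟨i, by omega⟩, rfl⟩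
    obtain ⟨j, rfl⟩ : ∃ k : Fin n, (k : ℕ) = j := ⟨⟨j, by omega⟩, rfl⟩
    rw [even_mem_interleavedPairs]
    constructor
    · intro h
      refine ⟨by omega, fun u v huv hu => ?_⟩
      rcases mem_interleavedPairs.1 huv with ⟨a, b, hab, rfl, rfl⟩ | ⟨a, b, hab, rfl, rfl⟩
      · omega
      · have := hab i j h
        simp only [Fin.lt_def] at this
        omega
    · intro h
      rcases lt_trichotomy i j with hij | rfl | hij
      · exact lt_case i j hij h
      · exact (blockRel π).refl _
      · exact (blockRel π).symm (lt_case j i hij h.symm)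
  · refine iff_of_false (fun h => ?_) (fun h => by have := h.1; omega)
    rcases mem_interleavedPairs.1 h with ⟨_, _, -, h1, h2⟩ | ⟨_, _, -, h1, h2⟩ <;> omega
  · refine iff_of_false (fun h => ?_) (fun h => by have := h.1; omega)
    rcases mem_interleavedPairs.1 h with ⟨_, _, -, h1, h2⟩ | ⟨_, _, -, h1, h2⟩ <;> omega
  · obtain ⟨i, rfl⟩ : ∃ k : Fin n, (k : ℕ) = i := ⟨⟨i, by omega⟩, rfl⟩
    obtain ⟨j, rfl⟩ : ∃ k : Fin n, (k : ℕ) = j := ⟨⟨j, by omega⟩, rfl⟩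
    rw [odd_mem_interleavedPairs]
    constructor
    · intro h
      refine ⟨by omega, fun u v huv hu => ?_⟩
      rcases mem_interleavedPairs.1 huv with ⟨a, b, hab, rfl, rfl⟩ | ⟨a, b, hab, rfl, rfl⟩
      · have := h a b hab
        simp only [Fin.lt_def] at this
        omega
      · omega
    · intro h a b hab
      have := h.2 _ _ (even_mem_interleavedPairs.2 hab) (by omega)
      simp only [Fin.lt_def]
      omega

/-- A Kreweras pair is determined by its restriction to the even points. -/
theorem krewerasPairs_ext {i j : ℕ} {r r' : Finset (ℕ × ℕ)} (hr : r ∈ krewerasPairs i j)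
    (hr' : r' ∈ krewerasPairs i j)
    (h : ∀ a b, (2 * a, 2 * b) ∈ r ↔ (2 * a, 2 * b) ∈ r') : r = r' := by
  have key : ∀ {r r' : Finset (ℕ × ℕ)}, r ∈ krewerasPairs i j → r' ∈ krewerasPairs i j →
      (∀ a b, (2 * a, 2 * b) ∈ r ↔ (2 * a, 2 * b) ∈ r') → r ⊆ r' := by
    rintro r r' hr hr' h ⟨x, y⟩ hxy
    have hb := (mem_krewerasPairs.1 hr).1 x y hxy
    obtain ⟨hpar, hsep⟩ := krewerasPairs_unseparated hr hxy
    rcases Nat.even_or_odd' x with ⟨a, rfl | rfl⟩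
    · obtain ⟨b, rfl⟩ : ∃ b, y = 2 * b := ⟨y / 2, by omega⟩
      exact (h a b).1 hxy
    · refine ((mem_krewerasPairs.1 hr').2 _ _ hb.1 hb.2.1 hb.2.2.1 hb.2.2.2).2
        ⟨hpar, fun u v huv hu => ?_⟩
      have hp := (krewerasPairs_unseparated hr' huv).1
      obtain ⟨u, rfl⟩ : ∃ b, u = 2 * b := ⟨u / 2, by omega⟩
      obtain ⟨v, rfl⟩ : ∃ b, v = 2 * b := ⟨v / 2, by omega⟩
      exact hsep _ _ ((h u v).2 huv) hu
  exact (key hr hr' h).antisymm (key hr' hr fun a b => (h a b).symm)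

/-- The restriction of `r` to the even points is noncrossing, and it determines `r` by
`krewerasPairs_ext`. -/
theorem exists_interleavedPairs_eq {r : Finset (ℕ × ℕ)} (hr : r ∈ krewerasPairs 0 (2 * n)) :
    ∃ π : NCPartition n, interleavedPairs π.1 = r := by
  classical
  let s : Setoid (Fin n) :=
    { r := fun i j => (2 * (i : ℕ), 2 * (j : ℕ)) ∈ r
      iseqv := ⟨fun i => krewerasPairs_refl hr (by omega) (by omega),
        fun h => krewerasPairs_symm hr h, fun h h' => krewerasPairs_trans hr h h'⟩ }
  have hs : IsNoncrossing s := by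
    intro a b c d hab hbc hcd hac hbd
    have h1 := krewerasPairs_unseparated hr hac
    have h2 := krewerasPairs_unseparated hr hbd
    -- An odd point between `a` and `b` lies between `a` and `c` but not between `b` and `d`; the
    -- points related to it inherit both properties.
    refine ((mem_krewerasPairs.1 hr).2 _ _ (by omega) (by omega) (by omega) (by omega)).2
      ⟨by omega, fun u v huv hu => ?_⟩
    have h3 := h1.2 u v huv hu
    have h4 := h2.2 u v huv (by omega)
    have h5 := (krewerasPairs_unseparated hr huv).1
    simp only [Fin.lt_def] at *
    omega
  have hπ : blockRel (Finpartition.ofSetoid s) = s := blockRel_ofSetoid s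
  have hnc : IsNoncrossing (blockRel (Finpartition.ofSetoid s)) := by rw [hπ]; exact hs
  refine ⟨⟨Finpartition.ofSetoid s, hnc⟩, krewerasPairs_ext (interleavedPairs_mem hnc) hr ?_⟩
  intro a b
  have hmem : ∀ a b : Fin n, (2 * (a : ℕ), 2 * (b : ℕ)) ∈
      interleavedPairs (Finpartition.ofSetoid s) ↔ (2 * (a : ℕ), 2 * (b : ℕ)) ∈ r := by
    intro a b
    rw [even_mem_interleavedPairs, hπ]
    exact Iff.rfl
  constructor
  · intro h
    have := (mem_krewerasPairs.1 (interleavedPairs_mem hnc)).1 _ _ h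
    exact (hmem ⟨a, by omega⟩ ⟨b, by omega⟩).1 h
  · intro h
    have := (mem_krewerasPairs.1 hr).1 _ _ h
    exact (hmem ⟨a, by omega⟩ ⟨b, by omega⟩).2 h

theorem prod_Ico_two_mul {M : Type*} [CommMonoid M] (F : ℕ → M) (n : ℕ) :
    ∏ x ∈ Finset.Ico 0 (2 * n), F x =
      (∏ i : Fin n, F (2 * (i : ℕ))) * ∏ i : Fin n, F (2 * (i : ℕ) + 1) := by
  rw [← Finset.range_eq_Ico, Fin.prod_univ_eq_prod_range (fun i => F (2 * i)) n,
    Fin.prod_univ_eq_prod_range (fun i => F (2 * i + 1)) n, ← Finset.prod_mul_distrib]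
  induction n with
  | zero => simp
  | succ n ih =>
    rw [mul_add_one, Finset.prod_range_succ, Finset.prod_range_succ, ih, Finset.prod_range_succ,
      mul_assoc]

theorem pairsWeight_interleavedPairs {R : Type*} [CommRing R] {c : ℕ → ℕ → R} {f g : R⟦X⟧}
    (hf : ∀ i k, c (2 * i) k = PowerSeries.coeff k f)
    (hg : ∀ i k, c (2 * i + 1) k = PowerSeries.coeff k g) (π : NCPartition n) :
    pairsWeight c 0 (interleavedPairs π.1) 0 (2 * n) =
      partitionCoeff f π * partitionCoeff g (kreweras π) := by
  classical
  have hKr : blockRel (kreweras π).1 = krewerasRel π.1 := blockRel_ofSetoid _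
  unfold pairsWeight
  rw [prod_Ico_two_mul, partitionCoeff_eq_prod, partitionCoeff_eq_prod, hKr]
  simp only [ite_self, add_zero, hf, hg]
  congr 1
  · refine Finset.prod_congr rfl fun i _ => ?_
    have hcard : ((interleavedPairs π.1).filter fun e => e.1 = 2 * (i : ℕ)).card =
        (Finset.univ.filter fun j => blockRel π.1 i j).card := by
      rw [← Finset.card_image_of_injective _
        (f := fun j : Fin n => (2 * (i : ℕ), 2 * (j : ℕ)))
        (fun a b h => by simp only [Prod.mk.injEq] at h; omega)]
      congr 1
      ext ⟨x, y⟩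
      simp only [Finset.mem_filter, Finset.mem_image, Finset.mem_univ, true_and, Prod.mk.injEq]
      constructor
      · rintro ⟨h, rfl⟩
        rcases mem_interleavedPairs.1 h with ⟨a, b, hab, h1, rfl⟩ | ⟨a, b, hab, h1, rfl⟩
        · obtain rfl : a = i := by omega
          exact ⟨b, hab, rfl, rfl⟩
        · omega
      · rintro ⟨j, h, rfl, rfl⟩
        exact ⟨even_mem_interleavedPairs.2 h, rfl⟩
    have hmax : (∀ e ∈ interleavedPairs π.1, e.1 = 2 * (i : ℕ) → e.2 ≤ 2 * (i : ℕ)) ↔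
        ∀ j, blockRel π.1 i j → j ≤ i := by
      constructor
      · intro h j hij
        have := h _ (even_mem_interleavedPairs.2 hij) rfl
        simp only [Fin.le_def] at *
        omega
      · rintro h ⟨x, y⟩ hxy rfl
        rcases mem_interleavedPairs.1 hxy with ⟨a, b, hab, h1, rfl⟩ | ⟨a, b, hab, h1, rfl⟩
        · obtain rfl : a = i := by omega
          have := h b hab
          simp only [Fin.le_def] at *
          omega
        · omega
    rw [hcard]
    simp only [hmax]
  · refine Finset.prod_congr rfl fun i _ => ?_
    have hcard : ((interleavedPairs π.1).filter fun e => e.1 = 2 * (i : ℕ) + 1).card =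
        (Finset.univ.filter fun j => krewerasRel π.1 i j).card := by
      rw [← Finset.card_image_of_injective _
        (f := fun j : Fin n => (2 * (i : ℕ) + 1, 2 * (j : ℕ) + 1))
        (fun a b h => by simp only [Prod.mk.injEq] at h; omega)]
      congr 1
      ext ⟨x, y⟩
      simp only [Finset.mem_filter, Finset.mem_image, Finset.mem_univ, true_and, Prod.mk.injEq]
      constructor
      · rintro ⟨h, rfl⟩
        rcases mem_interleavedPairs.1 h with ⟨a, b, hab, h1, rfl⟩ | ⟨a, b, hab, h1, rfl⟩
        · omega
        · obtain rfl : a = i := by omega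
          exact ⟨b, hab, rfl, rfl⟩
      · rintro ⟨j, h, rfl, rfl⟩
        exact ⟨odd_mem_interleavedPairs.2 h, rfl⟩
    have hmax : (∀ e ∈ interleavedPairs π.1, e.1 = 2 * (i : ℕ) + 1 → e.2 ≤ 2 * (i : ℕ) + 1) ↔
        ∀ j, krewerasRel π.1 i j → j ≤ i := by
      constructor
      · intro h j hij
        have := h _ (odd_mem_interleavedPairs.2 hij) rfl
        simp only [Fin.le_def] at *
        omega
      · rintro h ⟨x, y⟩ hxy rfl
        rcases mem_interleavedPairs.1 hxy with ⟨a, b, hab, h1, rfl⟩ | ⟨a, b, hab, h1, rfl⟩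
        · omega
        · obtain rfl : a = i := by omega
          have := h b hab
          simp only [Fin.le_def] at *
          omega
    rw [hcard]
    simp only [hmax]

theorem pairsSum_eq_sum_ncPartition {R : Type*} [CommRing R] {c : ℕ → ℕ → R} {f g : R⟦X⟧}
    (hf : ∀ i k, c (2 * i) k = PowerSeries.coeff k f)
    (hg : ∀ i k, c (2 * i + 1) k = PowerSeries.coeff k g) (n : ℕ) :
    pairsSum c 0 0 (2 * n) =
      ∑ π : NCPartition n, partitionCoeff f π * partitionCoeff g (kreweras π) := by
  symm
  refine Finset.sum_bij (fun π _ => interleavedPairs π.1) ?_ ?_ ?_ ?_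
  · exact fun π _ => interleavedPairs_mem π.2
  · intro π _ π' _ h
    apply Subtype.ext
    refine blockRel_injective (fun i j hij => ?_) (fun i j hij => ?_)
    · rw [← even_mem_interleavedPairs, ← h]
      exact even_mem_interleavedPairs.2 hij
    · rw [← even_mem_interleavedPairs]
      rw [h]
      exact even_mem_interleavedPairs.2 hij
  · intro r hr
    obtain ⟨π, h⟩ := exists_interleavedPairs_eq hr
    exact ⟨π, Finset.mem_univ _, h⟩
  · exact fun π _ => (pairsWeight_interleavedPairs hf hg π).symm

end

/-! ### Compositional inverses and the boxed convolution. -/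

section
variable {R : Type*} [CommRing R]

theorem IsCompInverse.symm {g h : R⟦X⟧} (hg : PowerSeries.constantCoeff g = 0)
    (H : IsCompInverse g h) : IsCompInverse h g :=
  ⟨hg, H.2.2, H.2.1⟩

/-- A left and a right inverse for composition agree. -/
theorem eq_of_subst_eq_X {g h k : R⟦X⟧} (hg : PowerSeries.constantCoeff g = 0)
    (hh : PowerSeries.constantCoeff h = 0)
    (h1 : PowerSeries.subst h g = (PowerSeries.X : R⟦X⟧))
    (h2 : PowerSeries.subst g k = (PowerSeries.X : R⟦X⟧)) : k = h := by
  have Hg := PowerSeries.HasSubst.of_constantCoeff_zero' hg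
  have Hh := PowerSeries.HasSubst.of_constantCoeff_zero' hh
  have := PowerSeries.subst_comp_subst_apply Hg Hh k
  rw [h1, h2, PowerSeries.X_subst, PowerSeries.subst_X Hh] at this
  exact this.symm

theorem IsCompInverse.unique {g h k : R⟦X⟧} (hg : PowerSeries.constantCoeff g = 0)
    (H : IsCompInverse g h) (K : IsCompInverse g k) : k = h :=
  eq_of_subst_eq_X hg H.1 H.2.1 K.2.2

theorem exists_isCompInverse {g : R⟦X⟧} (hg : PowerSeries.constantCoeff g = 0)
    (hu : IsUnit (PowerSeries.coeff 1 g)) :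
    ∃ h, IsCompInverse g h ∧ IsUnit (PowerSeries.coeff 1 h) := by
  refine ⟨PowerSeries.substInvOfIsUnit g hu, ⟨PowerSeries.constantCoeff_substInvOfIsUnit g hu,
    PowerSeries.subst_substInvOfIsUnit_right g hg hu,
    PowerSeries.subst_substInvOfIsUnit_left g hg hu⟩, ?_⟩
  rw [PowerSeries.coeff_one_substInvOfIsUnit]
  exact Units.isUnit _

/-- A two-sided inverse exists because the linear coefficient is a unit, and a one-sided inverse
must agree with it. -/
theorem isCompInverse_of_subst_eq_X {g k : R⟦X⟧} (hg : PowerSeries.constantCoeff g = 0)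
    (hu : IsUnit (PowerSeries.coeff 1 g))
    (h : PowerSeries.subst g k = (PowerSeries.X : R⟦X⟧)) : IsCompInverse g k := by
  obtain ⟨k', hk', -⟩ := exists_isCompInverse hg hu
  rwa [eq_of_subst_eq_X hg hk'.1 hk'.2.1 h]

theorem exists_units_isCompInverse {g : R⟦X⟧} (hg : PowerSeries.constantCoeff g = 0)
    (hu : IsUnit (PowerSeries.coeff 1 g)) :
    ∃ u : R⟦X⟧ˣ, IsCompInverse g (PowerSeries.X * (u : R⟦X⟧)) := by
  obtain ⟨h, hh, hunit⟩ := exists_isCompInverse hg hu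
  obtain ⟨u, rfl⟩ := PowerSeries.X_dvd_iff.2 hh.1
  have hu' : IsUnit u := by
    rw [PowerSeries.isUnit_iff_constantCoeff]
    simpa [PowerSeries.coeff_succ_X_mul] using hunit
  exact ⟨hu'.unit, hh⟩

theorem constantCoeff_X_mul (u : R⟦X⟧) :
    PowerSeries.constantCoeff (PowerSeries.X * u) = 0 := by
  simp

theorem isUnit_coeff_one_X_mul (u : R⟦X⟧ˣ) :
    IsUnit (PowerSeries.coeff 1 (PowerSeries.X * (u : R⟦X⟧))) := by
  have h := PowerSeries.isUnit_constantCoeff _ u.isUnit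
  rwa [← PowerSeries.coeff_zero_eq_constantCoeff_apply, ← PowerSeries.coeff_succ_X_mul] at h

theorem exists_of_units_isCompInverse (u : R⟦X⟧ˣ) :
    ∃ g : R⟦X⟧, PowerSeries.constantCoeff g = 0 ∧ IsUnit (PowerSeries.coeff 1 g) ∧
      IsCompInverse g (PowerSeries.X * (u : R⟦X⟧)) := by
  have h0 := constantCoeff_X_mul (u : R⟦X⟧)
  obtain ⟨g, hg, hunit⟩ := exists_isCompInverse h0 (isUnit_coeff_one_X_mul u)
  exact ⟨g, hg.1, hunit, hg.symm h0⟩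

/-- The block weights on the alternating points: the coefficients of `f` at the even points and
the coefficients of `g` at the odd points. -/
noncomputable def alternatingCoeff (f g : R⟦X⟧) (x k : ℕ) : R :=
  if x % 2 = 0 then PowerSeries.coeff k f else PowerSeries.coeff k g

theorem alternatingCoeff_even (f g : R⟦X⟧) (i k : ℕ) :
    alternatingCoeff f g (2 * i) k = PowerSeries.coeff k f :=
  if_pos (by omega)

theorem alternatingCoeff_odd (f g : R⟦X⟧) (i k : ℕ) :
    alternatingCoeff f g (2 * i + 1) k = PowerSeries.coeff k g :=
  if_neg (by omega)

theorem alternatingCoeff_add_two (f g : R⟦X⟧) (x : ℕ) :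
    alternatingCoeff f g (x + 2) = alternatingCoeff f g x := by
  ext k
  simp [alternatingCoeff]

/-- The coefficient `n` of `boxedConv f g` belongs to `2 * n` points, that of `evenSeries` to `2 * n
+ 2`: hence the factor `X`. -/
theorem boxedConv_eq_X_mul (f g : R⟦X⟧) :
    boxedConv f g = PowerSeries.X * (oddSeries (alternatingCoeff f g) 0 0 *
      oddSeries (alternatingCoeff f g) 0 1) := by
  rw [← evenSeries_eq_mul (alternatingCoeff_add_two f g)]
  ext n
  cases n with
  | zero => simp [boxedConv]
  | succ n =>
    rw [PowerSeries.coeff_succ_X_mul, boxedConv, evenSeries, PowerSeries.coeff_mk,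
      PowerSeries.coeff_mk, if_neg n.succ_ne_zero,
      ← pairsSum_eq_sum_ncPartition (alternatingCoeff_even f g) (alternatingCoeff_odd f g)]
    congr 1
    ring

theorem constantCoeff_boxedConv (f g : R⟦X⟧) : PowerSeries.constantCoeff (boxedConv f g) = 0 := by
  rw [boxedConv_eq_X_mul, constantCoeff_X_mul]

theorem constantCoeff_oddSeries (c : ℕ → ℕ → R) (i : ℕ) :
    PowerSeries.constantCoeff (oddSeries c 0 i) = c i 1 := by
  rw [oddSeries_eq_add]
  simp

theorem coeff_one_boxedConv (f g : R⟦X⟧) : PowerSeries.coeff 1 (boxedConv f g) =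
    PowerSeries.coeff 1 f * PowerSeries.coeff 1 g := by
  rw [boxedConv_eq_X_mul, PowerSeries.coeff_succ_X_mul,
    PowerSeries.coeff_zero_eq_constantCoeff_apply, map_mul, constantCoeff_oddSeries,
    constantCoeff_oddSeries]
  rfl

/-- `z f^{<-1>}(z) · z g^{<-1>}(z)` is `z²` times the compositional inverse of `f ⊠ g`. -/
theorem isCompInverse_boxedConv {f g : R⟦X⟧} (hf : PowerSeries.constantCoeff f = 0)
    (hg : PowerSeries.constantCoeff g = 0) (hfu : IsUnit (PowerSeries.coeff 1 f))
    (hgu : IsUnit (PowerSeries.coeff 1 g)) {u v : R⟦X⟧}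
    (hu : IsCompInverse f (PowerSeries.X * u)) (hv : IsCompInverse g (PowerSeries.X * v)) :
    IsCompInverse (boxedConv f g) (PowerSeries.X * (u * v)) := by
  set c := alternatingCoeff f g with hc
  have hc2 : ∀ x, c (x + 2) = c x := alternatingCoeff_add_two f g
  have h0 := constantCoeff_boxedConv f g
  have hunit : IsUnit (PowerSeries.coeff 1 (boxedConv f g)) := by
    rw [coeff_one_boxedConv]
    exact hfu.mul hgu
  have hconv : boxedConv f g = PowerSeries.X * (oddSeries c 0 0 * oddSeries c 0 1) :=
    boxedConv_eq_X_mul f g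
  -- The two functional equations `f(zB) = f ⊠ g = g(zA)`; in the second one the starting point `2`
  -- is shifted back to `0`.
  have hP : PowerSeries.subst (PowerSeries.X * oddSeries c 0 1) f = boxedConv f g := by
    rw [subst_oddSeries hc2 0 hf (alternatingCoeff_even f g 0), hconv]
    ring
  have hQ : PowerSeries.subst (PowerSeries.X * oddSeries c 0 0) g = boxedConv f g := by
    have := subst_oddSeries hc2 1 hg (alternatingCoeff_odd f g 0)
    rw [oddSeries_add_two hc2 0 0] at this
    rw [this, hconv]
    ring
  have Hh := PowerSeries.HasSubst.of_constantCoeff_zero' h0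
  -- Apply `f^{<-1>}` to `f(zB) = f ⊠ g`.
  have huP : PowerSeries.subst (boxedConv f g) (PowerSeries.X * u) =
      PowerSeries.X * oddSeries c 0 1 := by
    have HP := PowerSeries.HasSubst.of_constantCoeff_zero' (constantCoeff_X_mul (oddSeries c 0 1))
    rw [← hP, ← PowerSeries.subst_comp_subst_apply
      (PowerSeries.HasSubst.of_constantCoeff_zero' hf) HP, hu.2.2, PowerSeries.subst_X HP]
  have hvQ : PowerSeries.subst (boxedConv f g) (PowerSeries.X * v) =
      PowerSeries.X * oddSeries c 0 0 := by
    have HQ := PowerSeries.HasSubst.of_constantCoeff_zero' (constantCoeff_X_mul (oddSeries c 0 0))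
    rw [← hQ, ← PowerSeries.subst_comp_subst_apply
      (PowerSeries.HasSubst.of_constantCoeff_zero' hg) HQ, hv.2.2, PowerSeries.subst_X HQ]
  have hPu : IsUnit (oddSeries c 0 1) := by
    rw [PowerSeries.isUnit_iff_constantCoeff, constantCoeff_oddSeries]
    exact hgu
  have hQu : IsUnit (oddSeries c 0 0) := by
    rw [PowerSeries.isUnit_iff_constantCoeff, constantCoeff_oddSeries]
    exact hfu
  rw [PowerSeries.subst_mul Hh, PowerSeries.subst_X Hh] at huP hvQ
  -- With `h = zAB`, the equation `h u(h) = zB` can be cancelled by `zB`, as `B` is a unit.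
  have hu1 : oddSeries c 0 0 * PowerSeries.subst (boxedConv f g) u = 1 := by
    refine hPu.mul_left_cancel (PowerSeries.X_mul_cancel ?_)
    rw [mul_one, ← huP]
    nth_rewrite 2 [hconv]
    ring
  have hv1 : oddSeries c 0 1 * PowerSeries.subst (boxedConv f g) v = 1 := by
    refine hQu.mul_left_cancel (PowerSeries.X_mul_cancel ?_)
    rw [mul_one, ← hvQ]
    nth_rewrite 2 [hconv]
    ring
  refine isCompInverse_of_subst_eq_X h0 hunit ?_
  rw [PowerSeries.subst_mul Hh, PowerSeries.subst_mul Hh, PowerSeries.subst_X Hh]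
  calc boxedConv f g * (PowerSeries.subst (boxedConv f g) u * PowerSeries.subst (boxedConv f g) v)
      = PowerSeries.X * ((oddSeries c 0 0 * PowerSeries.subst (boxedConv f g) u) *
          (oddSeries c 0 1 * PowerSeries.subst (boxedConv f g) v)) := by
        nth_rewrite 1 [hconv]
        ring
    _ = PowerSeries.X := by rw [hu1, hv1, mul_one, mul_one]

theorem boxedConv_eq_X {f g : R⟦X⟧} (hf : PowerSeries.constantCoeff f = 0)
    (hg : PowerSeries.constantCoeff g = 0) (hfu : IsUnit (PowerSeries.coeff 1 f))
    (hgu : IsUnit (PowerSeries.coeff 1 g)) {u v : R⟦X⟧}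
    (hu : IsCompInverse f (PowerSeries.X * u)) (hv : IsCompInverse g (PowerSeries.X * v))
    (huv : u * v = 1) : boxedConv f g = PowerSeries.X := by
  have h := isCompInverse_boxedConv hf hg hfu hgu hu hv
  rw [huv, mul_one] at h
  have := h.2.1
  rwa [PowerSeries.X_subst] at this

end

/-! ### The two groups over the diagonal algebra. -/

section
variable {N : ℕ}

theorem mem_diagInv_iff {d : DiagAlg N} : d ∈ DiagInv N ↔ IsUnit d := by
  simp [DiagInv, Pi.isUnit_iff]

theorem mem_invSeries_iff {f : (DiagAlg N)⟦X⟧} : f ∈ InvSeries N ↔ IsUnit f := by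
  rw [PowerSeries.isUnit_iff_constantCoeff]
  exact mem_diagInv_iff

/-- Necessity compares first coefficients. For sufficiency, if `z u` is the compositional inverse of
`g`, then the series with compositional inverse `z u⁻¹` is the inverse for `⊠`. -/
theorem mem_thetaInv_iff {g : (DiagAlg N)⟦X⟧} :
    g ∈ ThetaInv N ↔
      PowerSeries.constantCoeff g = 0 ∧ IsUnit (PowerSeries.coeff 1 g) := by
  constructor
  · rintro ⟨hg, h, -, h1, -⟩
    refine ⟨hg, IsUnit.of_mul_eq_one (PowerSeries.coeff 1 h) ?_⟩
    rw [← coeff_one_boxedConv, h1, PowerSeries.coeff_one_X]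
  · rintro ⟨hg, hgu⟩
    obtain ⟨u, hu⟩ := exists_units_isCompInverse hg hgu
    obtain ⟨h, hh, hhu, hv⟩ := exists_of_units_isCompInverse u⁻¹
    exact ⟨hg, h, hh, boxedConv_eq_X hg hh hgu hhu hu hv u.mul_inv,
      boxedConv_eq_X hh hg hhu hgu hv hu u.inv_mul⟩

/-- The series with invertible constant term are the units of the ring of power series. -/
noncomputable def invSeriesEquiv (N : ℕ) : InvSeries N ≃ ((DiagAlg N)⟦X⟧)ˣ where
  toFun f := (mem_invSeries_iff.1 f.2).unit
  invFun u := ⟨u, mem_invSeries_iff.2 u.isUnit⟩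
  left_inv _ := rfl
  right_inv _ := Units.ext rfl

/-- The unit `u` for which `z u(z)` is the compositional inverse of `g`. -/
noncomputable def compInverseUnit (g : ThetaInv N) : ((DiagAlg N)⟦X⟧)ˣ :=
  (exists_units_isCompInverse (mem_thetaInv_iff.1 g.2).1 (mem_thetaInv_iff.1 g.2).2).choose

theorem compInverseUnit_spec (g : ThetaInv N) : IsCompInverse (g : (DiagAlg N)⟦X⟧)
    (PowerSeries.X * (compInverseUnit g : (DiagAlg N)⟦X⟧)) :=
  (exists_units_isCompInverse (mem_thetaInv_iff.1 g.2).1 (mem_thetaInv_iff.1 g.2).2).choose_spec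

theorem compInverseUnit_eq {g : ThetaInv N} {u : ((DiagAlg N)⟦X⟧)ˣ}
    (h : IsCompInverse (g : (DiagAlg N)⟦X⟧) (PowerSeries.X * (u : (DiagAlg N)⟦X⟧))) :
    compInverseUnit g = u :=
  Units.ext (PowerSeries.X_mul_cancel
    (h.unique (mem_thetaInv_iff.1 g.2).1 (compInverseUnit_spec g)))

/-- Surjectivity exceeds the claim about `F`, but it allows the group structure to be transported
from the units. -/
theorem compInverseUnit_bijective (N : ℕ) :
    Function.Bijective (compInverseUnit : ThetaInv N → ((DiagAlg N)⟦X⟧)ˣ) := by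
  constructor
  · intro f g h
    have h1 := compInverseUnit_spec f
    rw [h] at h1
    have h2 := compInverseUnit_spec g
    exact Subtype.ext ((h2.symm (mem_thetaInv_iff.1 g.2).1).unique h2.1
      (h1.symm (mem_thetaInv_iff.1 f.2).1))
  · intro u
    obtain ⟨g, hg, hgu, h⟩ := exists_of_units_isCompInverse u
    exact ⟨⟨g, mem_thetaInv_iff.2 ⟨hg, hgu⟩⟩, compInverseUnit_eq h⟩

/-- The bijection `g ↦ g^{<-1>}(z) / z`. -/
noncomputable def thetaInvEquiv (N : ℕ) : ThetaInv N ≃ ((DiagAlg N)⟦X⟧)ˣ :=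
  Equiv.ofBijective _ (compInverseUnit_bijective N)

theorem boxedConv_mem_thetaInv (f g : ThetaInv N) :
    boxedConv (f : (DiagAlg N)⟦X⟧) (g : (DiagAlg N)⟦X⟧) ∈ ThetaInv N := by
  rw [mem_thetaInv_iff, coeff_one_boxedConv]
  exact ⟨constantCoeff_boxedConv _ _,
    (mem_thetaInv_iff.1 f.2).2.mul (mem_thetaInv_iff.1 g.2).2⟩

theorem compInverseUnit_boxedConv (f g : ThetaInv N) :
    compInverseUnit ⟨_, boxedConv_mem_thetaInv f g⟩ = compInverseUnit f * compInverseUnit g := by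
  obtain ⟨hf, hfu⟩ := mem_thetaInv_iff.1 f.2
  obtain ⟨hg, hgu⟩ := mem_thetaInv_iff.1 g.2
  exact compInverseUnit_eq (isCompInverse_boxedConv hf hg hfu hgu (compInverseUnit_spec f)
    (compInverseUnit_spec g))

theorem X_mem_thetaInv (N : ℕ) : (PowerSeries.X : (DiagAlg N)⟦X⟧) ∈ ThetaInv N := by
  simp [mem_thetaInv_iff]

theorem compInverseUnit_X (N : ℕ) : compInverseUnit ⟨_, X_mem_thetaInv N⟩ = 1 := by
  refine compInverseUnit_eq ?_
  simp [IsCompInverse, PowerSeries.X_subst]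

end

theorem mainTheorem4 (N : ℕ) :
    (∀ g : (DiagAlg N)⟦X⟧,
      g ∈ ThetaInv N ↔ g ∈ Theta N ∧ PowerSeries.coeff 1 g ∈ DiagInv N) ∧
    (∀ g ∈ ThetaInv N, ∃! h : (DiagAlg N)⟦X⟧, IsCompInverse g h) ∧
    ∃ (_ : Group (ThetaInv N)) (_ : Group (InvSeries N)),
      (∀ f g : ThetaInv N,
        ((f * g : ThetaInv N) : (DiagAlg N)⟦X⟧)
          = boxedConv (f : (DiagAlg N)⟦X⟧) (g : (DiagAlg N)⟦X⟧)) ∧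
      ((1 : ThetaInv N) : (DiagAlg N)⟦X⟧) = PowerSeries.X ∧
      (∀ f g : InvSeries N,
        ((f * g : InvSeries N) : (DiagAlg N)⟦X⟧)
          = (f : (DiagAlg N)⟦X⟧) * (g : (DiagAlg N)⟦X⟧)) ∧
      ∃ F : ThetaInv N →* InvSeries N,
        (∀ g : ThetaInv N,
          IsCompInverse (g : (DiagAlg N)⟦X⟧) (PowerSeries.X * (F g : (DiagAlg N)⟦X⟧))) ∧
        Function.Injective F := by
  -- Both group structures are pulled back from the units of the power series ring.
  refine ⟨fun g => ?_, fun g hg => ?_, (thetaInvEquiv N).group, (invSeriesEquiv N).group, ?_⟩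
  · rw [mem_thetaInv_iff, mem_diagInv_iff]
    exact Iff.rfl
  · exact ⟨_, compInverseUnit_spec ⟨g, hg⟩,
      fun h hh => (compInverseUnit_spec ⟨g, hg⟩).unique (mem_thetaInv_iff.1 hg).1 hh⟩
  · let := (thetaInvEquiv N).group
    let := (invSeriesEquiv N).group
    refine ⟨fun f g => ?_, ?_, fun f g => rfl,
      ((invSeriesEquiv N).mulEquiv.symm.toMonoidHom.comp (thetaInvEquiv N).mulEquiv.toMonoidHom),
      compInverseUnit_spec, ?_⟩
    -- The transported product is the preimage of the product of units; by multiplicativity it is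
    -- the boxed convolution.
    · have : f * g = ⟨_, boxedConv_mem_thetaInv f g⟩ :=
        (thetaInvEquiv N).symm_apply_eq.2 (compInverseUnit_boxedConv f g).symm
      rw [this]
    · have : (1 : ThetaInv N) = ⟨_, X_mem_thetaInv N⟩ :=
        (thetaInvEquiv N).symm_apply_eq.2 (compInverseUnit_X N).symm
      rw [this]
    · exact (invSeriesEquiv N).symm.injective.comp (thetaInvEquiv N).injective
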